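/- Let $(\mathcal A,\cdot)$ be a finite-dimensional real commutative associative algebra (not necessarily unital). On the vector space $\mathcal A^*$ let $\nabla^0$ be the canonical affine connection, $(\nabla^0_XY)(\mu)=d_\mu Y(X(\mu))$. For one-forms $\alpha,\beta\in\Omega^1(\mathcal A^*)=C^\infty(\mathcal A^*,\mathcal A)$ put $$h(\alpha,\beta)(\mu)=\langle\mu,\alpha(\mu)\cdot\beta(\mu)\rangle ,$$ and let $h_\#:T^*\mathcal A^*\to T\mathcal A^*$ be given by $\beta(h_\#(\alpha))=h(\alpha,\beta)$. For $u\in\mathcal A$ let $L_u$ be the multiplication by $u$, $L_u^*$ its transpose, and $\Phi(u,\mu)=\exp(L_u^*)(\mu)$. Definitions. Let $M$ be a manifold with a connection $\nabla$ and let $h$ be a symmetric bivector field on $M$. Put $T(\alpha,\beta,\gamma)=(\nabla_{h_\#(\alpha)}h)(\beta,\gamma)$ and let $\mathcal D$ be the product on one-forms given by $\langle\mathcal D_\alpha\beta,X\rangle=(\nabla_Xh)(\alpha,\beta)+\langle\nabla^*_{h_\#(\alpha)}\beta,X\rangle$, where $\nabla^*$ is the dual connection. The triple $(M,\nabla,h)$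 is *generalized pseudo-Hessian* if $\nabla$ is torsionless and flat and $T(\alpha,\beta,\gamma)=T(\beta,\alpha,\gamma)$ for all one-forms. It is *generalized affine special real* if, moreover, $\mathcal DT=0$, i.e. $h_\#(\delta)\cdot T(\alpha,\beta,\gamma)=T(\mathcal D_\delta\alpha,\beta,\gamma)+T(\alpha,\mathcal D_\delta\beta,\gamma)+T(\alpha,\beta,\mathcal D_\delta\gamma)$ for all one-forms. A triple $(L,\nabla,g)$ with $\nabla$ a torsionless flat connection and $g$ a pseudo-Riemannian metric on $L$ is *pseudo-Hessian* if locally $g=\nabla d\phi$ for a smooth function $\phi$; it is *affine special real* if, moreover, the tensor field $S=\nabla g$ satisfies $\nabla S=0$. A *leaf* of $\mathrm{Im}\,h_\#$ is a maximal connected integral manifold: a connected, injectively immersed manifold whose tangent space at each point is $\mathrm{Im}\,h_\#$, and such that every connected integral manifold meeting it is an open submanifold of it. **Theorem.** 1. $(\mathcal A^*,\nabla^0,h)$ is a generalized pseudo-Hessian manifold. 2. $\Phi$ is a smooth action, by linear maps, of the abelian Lie group $(\mathcal A,+)$ on $\mathcal A^*$. The leaves of $\mathrm{Im}\,h_\#$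 are exactly the orbits of $\Phi$: the underlying set of every leaf is an orbit, and every orbit is the underlying set of a leaf. 3. Each orbit $L$ of $\Phi$, as a leaf, is a pseudo-Hessian manifold $(L,\nabla^L,g_L)$, where $\nabla^L$ is the connection induced by $\nabla^0$ and $g_L$ is given by $g_L(h_\#(\alpha),h_\#(\beta))=h(\alpha,\beta)$. If $\mathcal A^4=0$, then each $(L,\nabla^L,g_L)$ is an affine special real manifold. 4. $(\mathcal A^*,\nabla^0,h)$ is a generalized affine special real manifold if and only if $\mathcal A^4=0$, where $\mathcal A^4$ is the span of all products of four elements of $\mathcal A$. -/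

import Mathlib

open Bundle Set
open scoped Manifold ContDiff Topology

noncomputable section

namespace PseudoHessian

/-- A finite-dimensional space is canonically isomorphic to its bidual. -/
def bidual (F : Type*) [NormedAddCommGroup F] [NormedSpace ℝ F] [FiniteDimensional ℝ F] :
    F ≃ₗ[ℝ] ((F →L[ℝ] ℝ) →L[ℝ] ℝ) :=
  ((Module.evalEquiv ℝ F).trans (LinearMap.toContinuousLinearMap (𝕜 := ℝ) (E := F)
    (F' := ℝ)).symm.dualMap).trans (LinearMap.toContinuousLinearMap (𝕜 := ℝ) (E := F →L[ℝ] ℝ)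
    (F' := ℝ))

lemma bidual_apply (F : Type*) [NormedAddCommGroup F] [NormedSpace ℝ F] [FiniteDimensional ℝ F]
    (v : F) (α : F →L[ℝ] ℝ) : bidual F v α = α v := rfl

/-! ### Generalized pseudo-Hessian and pseudo-Hessian manifolds -/

section Basic

variable {E : Type*} [NormedAddCommGroup E] [NormedSpace ℝ E]
  {M : Type*} [TopologicalSpace M] [ChartedSpace E M]

variable (E M) in
/-- (Not necessarily smooth) vector fields on a boundaryless manifold `M` modelled on `E`. -/
abbrev VField := Π x : M, TangentSpace 𝓘(ℝ, E) x

variable (E M) in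
/-- (Not necessarily smooth) differential one-forms on `M`. -/
abbrev OForm := Π x : M, TangentSpace 𝓘(ℝ, E) x →L[ℝ] ℝ

variable (E M) in
/-- (Not necessarily smooth) fields of bilinear forms on the cotangent spaces of `M`. -/
abbrev BiVField :=
  Π x : M, (TangentSpace 𝓘(ℝ, E) x →L[ℝ] ℝ) →L[ℝ] (TangentSpace 𝓘(ℝ, E) x →L[ℝ] ℝ) →L[ℝ] ℝ

variable (E M) in
/-- (Not necessarily smooth) fields of bilinear forms on the tangent spaces of `M`. -/
abbrev BiForm :=
  Π x : M, TangentSpace 𝓘(ℝ, E) x →L[ℝ] TangentSpace 𝓘(ℝ, E) x →L[ℝ] ℝ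

/-- Exchange of the two arguments of a bilinear form on a tangent space. -/
def flipTangent {x : M}
    (B : TangentSpace 𝓘(ℝ, E) x →L[ℝ] TangentSpace 𝓘(ℝ, E) x →L[ℝ] ℝ) :
    TangentSpace 𝓘(ℝ, E) x →L[ℝ] TangentSpace 𝓘(ℝ, E) x →L[ℝ] ℝ :=
  ContinuousLinearMap.flip (E := E) (F := E) (G := ℝ) B

lemma flipTangent_apply {x : M}
    (B : TangentSpace 𝓘(ℝ, E) x →L[ℝ] TangentSpace 𝓘(ℝ, E) x →L[ℝ] ℝ)
    (v w : TangentSpace 𝓘(ℝ, E) x) : flipTangent B v w = B w v := rfl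

/-- Exchange of the two arguments of a bilinear form on a cotangent space. -/
def flipCotangent {x : M}
    (B : (TangentSpace 𝓘(ℝ, E) x →L[ℝ] ℝ) →L[ℝ] (TangentSpace 𝓘(ℝ, E) x →L[ℝ] ℝ) →L[ℝ] ℝ) :
    (TangentSpace 𝓘(ℝ, E) x →L[ℝ] ℝ) →L[ℝ] (TangentSpace 𝓘(ℝ, E) x →L[ℝ] ℝ) →L[ℝ] ℝ :=
  ContinuousLinearMap.flip (E := E →L[ℝ] ℝ) (F := E →L[ℝ] ℝ) (G := ℝ) B

lemma flipCotangent_apply {x : M}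
    (B : (TangentSpace 𝓘(ℝ, E) x →L[ℝ] ℝ) →L[ℝ] (TangentSpace 𝓘(ℝ, E) x →L[ℝ] ℝ) →L[ℝ] ℝ)
    (α β : TangentSpace 𝓘(ℝ, E) x →L[ℝ] ℝ) : flipCotangent B α β = B β α := rfl

/-- The map `h_# : T*M → TM`, characterised by `β (h_#(α)) = h(α, β)`. -/
def sharp [FiniteDimensional ℝ E] (h : BiVField E M) (x : M) :
    (TangentSpace 𝓘(ℝ, E) x →L[ℝ] ℝ) →ₗ[ℝ] TangentSpace 𝓘(ℝ, E) x :=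
  (bidual E).symm.toLinearMap ∘ₗ (h x).toLinearMap

lemma apply_sharp [FiniteDimensional ℝ E] (h : BiVField E M) (x : M) (α β : TangentSpace 𝓘(ℝ, E) x →L[ℝ] ℝ) :
    β (sharp h x α) = h x α β := by
  have := congrArg (fun f : (E →L[ℝ] ℝ) →L[ℝ] ℝ => f β) ((bidual E).apply_symm_apply (h x α))
  exact this

variable [IsManifold 𝓘(ℝ, E) ∞ M]

variable (E M) in
/-- Connections on the tangent bundle; `cov Y x (X x)` is `(∇_X Y)(x)`. -/
abbrev Conn := CovariantDerivative 𝓘(ℝ, E) E (TangentSpace 𝓘(ℝ, E) : M → Type _)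

/-- A one-form as a section of the cotangent bundle. -/
abbrev OForm.toSection (α : OForm E M) (x : M) :
    TotalSpace (E →L[ℝ] ℝ) (fun x : M => TangentSpace 𝓘(ℝ, E) x →L[ℝ] Bundle.Trivial M ℝ x) :=
  ⟨x, α x⟩

/-- Smooth vector fields. -/
def VField.Smooth (X : VField E M) : Prop :=
  ContMDiff 𝓘(ℝ, E) (𝓘(ℝ, E).prod 𝓘(ℝ, E)) ∞
    (fun x => (⟨x, X x⟩ : TotalSpace E (TangentSpace 𝓘(ℝ, E) : M → Type _)))

/-- Smooth one-forms. -/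
def OForm.Smooth (α : OForm E M) : Prop :=
  ContMDiff 𝓘(ℝ, E) (𝓘(ℝ, E).prod 𝓘(ℝ, E →L[ℝ] ℝ)) ∞ α.toSection

lemma OForm.mdiff_apply {α : OForm E M} {x : M} {Y : VField E M}
    (hα : MDifferentiableAt 𝓘(ℝ, E) (𝓘(ℝ, E).prod 𝓘(ℝ, E →L[ℝ] ℝ)) α.toSection x)
    (hY : MDiffAt (T% Y) x) :
    MDifferentiableAt 𝓘(ℝ, E) 𝓘(ℝ, ℝ) (fun y => α y (Y y)) x := by
  have := MDifferentiableAt.clm_bundle_apply (F₁ := E) (F₂ := ℝ)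
    (E₁ := (TangentSpace 𝓘(ℝ, E) : M → Type _)) (E₂ := Bundle.Trivial M ℝ)
    (b := fun m => m) (ϕ := α) (v := Y) hα hY
  exact (mdifferentiableAt_totalSpace _ _ |>.1 this).2

lemma dual_tensorial (cov : Conn E M) (α : OForm E M) (x : M)
    (hα : MDifferentiableAt 𝓘(ℝ, E) (𝓘(ℝ, E).prod 𝓘(ℝ, E →L[ℝ] ℝ)) α.toSection x) :
    TensorialAt 𝓘(ℝ, E) E
      (fun Y : VField E M =>
        mvfderiv 𝓘(ℝ, E) (fun y => α y (Y y)) x - (α x).comp (cov Y x)) x where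
  smul {f Y} hf hY := by
    have h1 := OForm.mdiff_apply hα hY
    have h2 := mvfderiv_mul hf h1
    have h3 : (fun y => α y ((f • Y) y)) = f * fun y => α y (Y y) := by
      ext y; simp
    rw [h3, h2, cov.isCovariantDerivativeOnUniv.leibniz hY hf]
    ext v
    simp
    ring
  add {Y Z} hY hZ := by
    have h1 := mvfderiv_add (OForm.mdiff_apply hα hY) (OForm.mdiff_apply hα hZ)
    have h3 : (fun y => α y ((Y + Z) y)) = (fun y => α y (Y y)) + fun y => α y (Z y) := by
      ext y; simp
    rw [h3, h1, cov.isCovariantDerivativeOnUniv.add hY hZ]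
    ext v
    simp
    ring


variable [FiniteDimensional ℝ E]

open Classical in
/-- The dual connection on one-forms, `dualCov cov β x v = (∇*_v β)(x)`, characterised by
`(∇*_X β)(Y) = X (β(Y)) - β(∇_X Y)`; the value is `0` where `β` is not differentiable. -/
def dualCov (cov : Conn E M) (β : OForm E M) (x : M) :
    TangentSpace 𝓘(ℝ, E) x →L[ℝ] TangentSpace 𝓘(ℝ, E) x →L[ℝ] ℝ :=
  if hβ : MDifferentiableAt 𝓘(ℝ, E) (𝓘(ℝ, E).prod 𝓘(ℝ, E →L[ℝ] ℝ)) β.toSection x then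
    flipTangent (TensorialAt.mkHom _ x (dual_tensorial cov β x hβ))
  else 0

lemma dualCov_apply (cov : Conn E M) {β : OForm E M} {x : M}
    (hβ : MDifferentiableAt 𝓘(ℝ, E) (𝓘(ℝ, E).prod 𝓘(ℝ, E →L[ℝ] ℝ)) β.toSection x)
    {Y : VField E M} (hY : MDiffAt (T% Y) x) (v : TangentSpace 𝓘(ℝ, E) x) :
    dualCov cov β x v (Y x) =
      mvfderiv 𝓘(ℝ, E) (fun y => β y (Y y)) x v - β x (cov Y x v) := by
  rw [dualCov, dif_pos hβ, flipTangent_apply]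
  have := TensorialAt.mkHom_apply (dual_tensorial cov β x hβ) hY
  exact congrArg (fun f : TangentSpace 𝓘(ℝ, E) x →L[ℝ] ℝ => f v) this

/-- `nablaBiv cov h β γ x v = (∇_v h)(β, γ)` at `x`. -/
def nablaBiv (cov : Conn E M) (h : BiVField E M) (β γ : OForm E M) (x : M) :
    TangentSpace 𝓘(ℝ, E) x →L[ℝ] ℝ :=
  mvfderiv 𝓘(ℝ, E) (fun y => h y (β y) (γ y)) x
    - (flipCotangent (h x) (γ x)).comp (dualCov cov β x) - (h x (β x)).comp (dualCov cov γ x)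

/-- The tensor field `T(α, β, γ) = (∇_{h_#(α)} h)(β, γ)`. -/
def tensorT (cov : Conn E M) (h : BiVField E M) (α β γ : OForm E M) (x : M) : ℝ :=
  nablaBiv cov h β γ x (sharp h x (α x))

/-- The anchored product `𝓓` on one-forms: `(𝓓_α β)(X) = (∇_X h)(α, β) + (∇*_{h_#(α)} β)(X)`. -/
def anchoredProd (cov : Conn E M) (h : BiVField E M) (α β : OForm E M) : OForm E M :=
  fun x => nablaBiv cov h α β x + dualCov cov β x (sharp h x (α x))

/-- `(M, ∇)` is an affine manifold: `∇` is smooth, torsionless and flat. -/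
structure IsAffine (cov : Conn E M) : Prop where
  smooth : CovariantDerivative.ContMDiffCovariantDerivative cov ∞
  torsionless : cov.torsion = 0
  flat : ∀ X Y Z : VField E M, X.Smooth → Y.Smooth → Z.Smooth → ∀ x,
    cov (fun y => cov Z y (Y y)) x (X x) - cov (fun y => cov Z y (X y)) x (Y x)
      - cov Z x (VectorField.mlieBracket 𝓘(ℝ, E) X Y x) = 0

/-- `h` is a (smooth) symmetric bivector field. -/
structure IsSymmBivector (h : BiVField E M) : Prop where
  smooth : ∀ α β : OForm E M, α.Smooth → β.Smooth →
    ContMDiff 𝓘(ℝ, E) 𝓘(ℝ, ℝ) ∞ (fun x => h x (α x) (β x))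
  symm : ∀ x α β, h x α β = h x β α

/-- `(M, ∇, h)` is a generalized pseudo-Hessian manifold. -/
structure IsGenPseudoHessian (cov : Conn E M) (h : BiVField E M) : Prop where
  affine : IsAffine cov
  bivector : IsSymmBivector h
  codazzi : ∀ α β γ : OForm E M, α.Smooth → β.Smooth → γ.Smooth → ∀ x,
    tensorT cov h α β γ x = tensorT cov h β α γ x

/-- `(M, ∇, h)` is a generalized affine special real manifold: it is generalized pseudo-Hessian and
the tensor field `T` is parallel with respect to the anchored product `𝓓`. -/
structure IsGenAffineSpecialReal (cov : Conn E M) (h : BiVField E M) : Prop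
    extends IsGenPseudoHessian cov h where
  parallel : ∀ δ α β γ : OForm E M, δ.Smooth → α.Smooth → β.Smooth → γ.Smooth → ∀ x,
    mvfderiv 𝓘(ℝ, E) (tensorT cov h α β γ) x (sharp h x (δ x))
      - tensorT cov h (anchoredProd cov h δ α) β γ x
      - tensorT cov h α (anchoredProd cov h δ β) γ x
      - tensorT cov h α β (anchoredProd cov h δ γ) x = 0

/-! ### Pseudo-Hessian manifolds -/

/-- `g` is a (smooth) pseudo-Riemannian metric. -/
structure IsPseudoRiemannian (g : BiForm E M) : Prop where
  smooth : ∀ X Y : VField E M, X.Smooth → Y.Smooth →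
    ContMDiff 𝓘(ℝ, E) 𝓘(ℝ, ℝ) ∞ (fun x => g x (X x) (Y x))
  symm : ∀ x v w, g x v w = g x w v
  nondegenerate : ∀ x v, (∀ w, g x v w = 0) → v = 0

/-- `(M, ∇, g)` is a pseudo-Hessian manifold: `∇` is torsionless and flat, and the
pseudo-Riemannian metric `g` is locally of the form `∇dφ`, where
`(∇dφ)(X, Y) = X (dφ(Y)) - dφ(∇_X Y)`. -/
structure IsPseudoHessian (cov : Conn E M) (g : BiForm E M) : Prop where
  affine : IsAffine cov
  metric : IsPseudoRiemannian g
  hessian : ∀ x : M, ∃ U : Set M, IsOpen U ∧ x ∈ U ∧ ∃ φ : M → ℝ,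
    ContMDiffOn 𝓘(ℝ, E) 𝓘(ℝ, ℝ) ∞ φ U ∧
    ∀ X Y : VField E M, X.Smooth → Y.Smooth → ∀ y ∈ U,
      g y (X y) (Y y) =
        mvfderiv 𝓘(ℝ, E) (fun z => mvfderiv 𝓘(ℝ, E) φ z (Y z)) y (X y)
          - mvfderiv 𝓘(ℝ, E) φ y (cov Y y (X y))

/-- The tensor field `S = ∇g`:
`S(X, Y, Z) = X (g(Y, Z)) - g(∇_X Y, Z) - g(Y, ∇_X Z)`. -/
def nablaMetric (cov : Conn E M) (g : BiForm E M) (X Y Z : VField E M) (x : M) : ℝ :=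
  mvfderiv 𝓘(ℝ, E) (fun y => g y (Y y) (Z y)) x (X x)
    - g x (cov Y x (X x)) (Z x) - g x (Y x) (cov Z x (X x))

/-- `(M, ∇, g)` is an affine special real manifold: it is pseudo-Hessian and `S = ∇g` is
`∇`-parallel. -/
structure IsAffineSpecialReal (cov : Conn E M) (g : BiForm E M) : Prop
    extends IsPseudoHessian cov g where
  parallel : ∀ W X Y Z : VField E M, W.Smooth → X.Smooth → Y.Smooth → Z.Smooth → ∀ x,
    mvfderiv 𝓘(ℝ, E) (nablaMetric cov g X Y Z) x (W x)
      - nablaMetric cov g (fun y => cov X y (W y)) Y Z x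
      - nablaMetric cov g X (fun y => cov Y y (W y)) Z x
      - nablaMetric cov g X Y (fun y => cov Z y (W y)) x = 0

end Basic

/-! ### Leaves of a singular distribution -/

section Leaves

universe u

variable {E : Type*} [NormedAddCommGroup E] [NormedSpace ℝ E]
  {M : Type u} [TopologicalSpace M] [ChartedSpace E M]

/-- A connected integral manifold of the singular distribution `D` on `M`: a connected, injectively
immersed manifold (Hausdorff, second countable), whose tangent space at each point is the
corresponding value of `D`. -/
structure IntegralManifold (D : Π x : M, Submodule ℝ (TangentSpace 𝓘(ℝ, E) x)) where
  dim : ℕ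
  carrier : Type u
  [top : TopologicalSpace carrier]
  [charted : ChartedSpace (EuclideanSpace ℝ (Fin dim)) carrier]
  [manifold : IsManifold 𝓘(ℝ, EuclideanSpace ℝ (Fin dim)) ∞ carrier]
  [hausdorff : T2Space carrier]
  [secondCountable : SecondCountableTopology carrier]
  [connected : ConnectedSpace carrier]
  incl : carrier → M
  smooth : ContMDiff 𝓘(ℝ, EuclideanSpace ℝ (Fin dim)) 𝓘(ℝ, E) ∞ incl
  injective : Function.Injective incl
  immersive : ∀ p, Function.Injective
    (mfderiv 𝓘(ℝ, EuclideanSpace ℝ (Fin dim)) 𝓘(ℝ, E) incl p)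
  tangent : ∀ p, (mfderiv 𝓘(ℝ, EuclideanSpace ℝ (Fin dim)) 𝓘(ℝ, E) incl p).range = D (incl p)

namespace IntegralManifold

attribute [instance] top charted manifold hausdorff secondCountable connected

variable {D : Π x : M, Submodule ℝ (TangentSpace 𝓘(ℝ, E) x)}

/-- The model space of an integral manifold. -/
abbrev Model (L : IntegralManifold D) : Type := EuclideanSpace ℝ (Fin L.dim)

/-- A leaf of `D` is a maximal connected integral manifold: every connected integral manifold
that meets it is an open submanifold of it. -/
def IsLeaf (L : IntegralManifold D) : Prop :=
  ∀ L' : IntegralManifold D, (range L'.incl ∩ range L.incl).Nonempty →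
    ∃ j : L'.carrier → L.carrier, L.incl ∘ j = L'.incl ∧ Topology.IsOpenEmbedding j ∧
      ContMDiff 𝓘(ℝ, L'.Model) 𝓘(ℝ, L.Model) ∞ j

/-- The metric `g_L` on an integral manifold of `Im h_#`, characterised by
`g_L(h_#(α), h_#(β)) = h(α, β)`. -/
def IsInducedMetric [FiniteDimensional ℝ E] (h : BiVField E M) (L : IntegralManifold D)
    (g : BiForm L.Model L.carrier) : Prop :=
  ∀ (p : L.carrier) (v w : TangentSpace 𝓘(ℝ, L.Model) p)
    (α β : TangentSpace 𝓘(ℝ, E) (L.incl p) →L[ℝ] ℝ),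
    mfderiv 𝓘(ℝ, L.Model) 𝓘(ℝ, E) L.incl p v = sharp h (L.incl p) α →
    mfderiv 𝓘(ℝ, L.Model) 𝓘(ℝ, E) L.incl p w = sharp h (L.incl p) β →
    g p v w = h (L.incl p) α β

variable [IsManifold 𝓘(ℝ, E) ∞ M]

/-- The connection `covL` on the integral manifold `L` is induced by the connection `cov` of the
ambient manifold: if vector fields `X`, `Y` on `L` are given near `p` by the restrictions of vector
fields `X'`, `Y'` on `M`, then `∇^L_X Y` is given at `p` by `∇_{X'} Y'`. -/
def IsInducedConnection (cov : Conn E M) (L : IntegralManifold D)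
    (covL : Conn L.Model L.carrier) : Prop :=
  ∀ (X Y : VField L.Model L.carrier) (X' Y' : VField E M),
    X.Smooth → Y.Smooth → X'.Smooth → Y'.Smooth → ∀ p : L.carrier,
    (∀ᶠ q in 𝓝 p, mfderiv 𝓘(ℝ, L.Model) 𝓘(ℝ, E) L.incl q (X q) = X' (L.incl q)) →
    (∀ᶠ q in 𝓝 p, mfderiv 𝓘(ℝ, L.Model) 𝓘(ℝ, E) L.incl q (Y q) = Y' (L.incl q)) →
    mfderiv 𝓘(ℝ, L.Model) 𝓘(ℝ, E) L.incl p (covL Y p (X p)) =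
      cov Y' (L.incl p) (X' (L.incl p))

end IntegralManifold

end Leaves

/-- The singular distribution `Im h_#`. -/
def imSharp {E : Type*} [NormedAddCommGroup E] [NormedSpace ℝ E] [FiniteDimensional ℝ E]
    {M : Type*} [TopologicalSpace M] [ChartedSpace E M]
    (h : BiVField E M) (x : M) : Submodule ℝ (TangentSpace 𝓘(ℝ, E) x) :=
  LinearMap.range (sharp h x)

lemma mdifferentiableAt_vectorSpace_iff {V : Type*} [NormedAddCommGroup V] [NormedSpace ℝ V]
    {σ : V → V} {x : V} :
    MDifferentiableAt 𝓘(ℝ, V) (𝓘(ℝ, V).prod 𝓘(ℝ, V))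
      (fun y => (⟨y, σ y⟩ : TotalSpace V (TangentSpace 𝓘(ℝ, V) : V → Type _))) x ↔
    DifferentiableAt ℝ σ x := by
  rw [mdifferentiableAt_totalSpace, ← mdifferentiableAt_iff_differentiableAt]
  have : (fun y => (trivializationAt V (TangentSpace 𝓘(ℝ, V) : V → Type _) x
      (⟨y, σ y⟩ : TotalSpace V (TangentSpace 𝓘(ℝ, V) : V → Type _))).2) = σ := by
    ext y
    simp
  rw [this]
  exact and_iff_right mdifferentiableAt_id

/-- The canonical affine connection `(∇⁰_X Y)(μ) = d_μ Y (X(μ))` of a vector space. -/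
def canonicalConn (V : Type*) [NormedAddCommGroup V] [NormedSpace ℝ V] : Conn V V where
  toFun Y x := fderiv ℝ (E := V) (F := V) Y x
  isCovariantDerivativeOnUniv := by
    constructor
    · intro σ σ' x hσ hσ' _
      exact fderiv_add (E := V) (F := V) (mdifferentiableAt_vectorSpace_iff.1 hσ)
        (mdifferentiableAt_vectorSpace_iff.1 hσ')
    · intro σ g x hσ hg _
      have h1 := mdifferentiableAt_vectorSpace_iff.1 hσ
      have h2 := hg.differentiableAt
      have h3 := fderiv_smul (E := V) (F := V) h2 h1
      have h4 : mvfderiv 𝓘(ℝ, V) g x = fderiv ℝ g x := by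
        ext v
        simp only [mvfderiv, mfderiv_eq_fderiv]
        rfl
      rw [h4]
      exact h3

/-! ### The dual of a commutative associative algebra -/

section Algebra

/-- The dual space `A*` of a finite-dimensional real vector space `A`, as a normed space. -/
def DualSpace (A : Type*) [NormedAddCommGroup A] [NormedSpace ℝ A] : Type _ := A →L[ℝ] ℝ

section

variable (A : Type*) [NormedAddCommGroup A] [NormedSpace ℝ A]

instance : NormedAddCommGroup (DualSpace A) := inferInstanceAs (NormedAddCommGroup (A →L[ℝ] ℝ))
instance : NormedSpace ℝ (DualSpace A) := inferInstanceAs (NormedSpace ℝ (A →L[ℝ] ℝ))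
instance : FunLike (DualSpace A) A ℝ := inferInstanceAs (FunLike (A →L[ℝ] ℝ) A ℝ)
instance : ContinuousLinearMapClass (DualSpace A) ℝ A ℝ :=
  inferInstanceAs (ContinuousLinearMapClass (A →L[ℝ] ℝ) ℝ A ℝ)

variable [FiniteDimensional ℝ A]

instance : FiniteDimensional ℝ (DualSpace A) :=
  inferInstanceAs (FiniteDimensional ℝ (A →L[ℝ] ℝ))

/-- The canonical isomorphism `A = A**`. -/
def toBidual : A ≃ₗ[ℝ] (DualSpace A →L[ℝ] ℝ) := bidual A

lemma toBidual_apply (a : A) (μ : DualSpace A) : toBidual A a μ = μ a := rfl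

end

variable {A : Type*} [NormedAddCommGroup A] [NormedSpace ℝ A] [FiniteDimensional ℝ A]

/-- The bilinear form `(α, β) ↦ μ (α · β)` on `A** = A`. -/
def dualBivAt (mul : A →ₗ[ℝ] A →ₗ[ℝ] A) (μ : DualSpace A) :
    (DualSpace A →L[ℝ] ℝ) →L[ℝ] (DualSpace A →L[ℝ] ℝ) →L[ℝ] ℝ :=
  LinearMap.toContinuousBilinearMap
    ((mul.compl₁₂ (toBidual A).symm.toLinearMap (toBidual A).symm.toLinearMap).compr₂
      (μ : A →ₗ[ℝ] ℝ))

/-- The bivector field `h(α, β)(μ) = μ (α(μ) · β(μ))` on `A*`, where the one-forms `α`, `β` on `A*`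
are viewed as `A`-valued functions through `A = A**`. -/
def dualBiv (mul : A →ₗ[ℝ] A →ₗ[ℝ] A) : BiVField (DualSpace A) (DualSpace A) :=
  fun μ => dualBivAt mul μ

lemma dualBiv_apply (mul : A →ₗ[ℝ] A →ₗ[ℝ] A) (μ : DualSpace A) (a b : A) :
    dualBiv mul μ (toBidual A a) (toBidual A b) = μ (mul a b) := by
  have h : dualBivAt mul μ (toBidual A a) (toBidual A b) = μ (mul a b) := by
    simp [dualBivAt]
  exact h

/-- `L_u* : A* → A*`, the transpose of the multiplication `L_u` by `u`. -/
def mulTranspose (mul : A →ₗ[ℝ] A →ₗ[ℝ] A) (u : A) : DualSpace A →L[ℝ] DualSpace A :=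
  (ContinuousLinearMap.compL ℝ A A ℝ).flip (LinearMap.toContinuousLinearMap (mul u))

lemma mulTranspose_apply (mul : A →ₗ[ℝ] A →ₗ[ℝ] A) (u : A) (μ : DualSpace A) (v : A) :
    mulTranspose mul u μ v = μ (mul u v) := rfl

/-- `Φ(u, μ) = exp(L_u*)(μ)`. -/
def expAction (mul : A →ₗ[ℝ] A →ₗ[ℝ] A) (u : A) (μ : DualSpace A) : DualSpace A :=
  NormedSpace.exp (mulTranspose mul u) μ

/-- The orbit of `μ` under the action `Φ`. -/
def expOrbit (mul : A →ₗ[ℝ] A →ₗ[ℝ] A) (μ : DualSpace A) : Set (DualSpace A) :=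
  range fun u => expAction mul u μ

/-- `A⁴`, the span of all products of four elements. -/
def fourthPower (mul : A →ₗ[ℝ] A →ₗ[ℝ] A) : Submodule ℝ A :=
  Submodule.span ℝ {z | ∃ a b c d : A, z = mul (mul (mul a b) c) d}

end Algebra

end PseudoHessian

end

/-! Identify one-forms on A* with A-valued functions. For constant forms, h(a,b)(μ) = μ(ab) is
linear in μ, so ∇⁰ differentiates only the base point: (∇_v h)(a,b) = v(ab). With h_#(a) = L_a*μ
this gives T(a,b,c) = μ(abc), which is symmetric. Its 𝓓-derivative is -2 μ(dabc), which vanishes for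
all μ and all forms exactly when A⁴ = 0 (`tensorT_formOf`, `parallel_formOf`).

For the leaves, let A·μ be the space of all L_a*μ; it is the value of Im h_# at μ. The operators
L_a* commute, so Φ is an action, and L_b*L_a* = L_{ba}*, so the exponential series keeps the orbit
of μ inside the affine space μ + A·μ. The space A·ν does not change along the orbit
(`tangentSpan_expAction`), and u ↦ Φ(u,ν) has image of derivative A·ν at 0, so the orbit is open in
μ + A·μ (`Frame.isOpen_domain`). It thus has one global affine chart, and the induced connection is
ordinary differentiation there.

For maximality, a curve with γ' = L_{u(t)}*γ satisfies (exp(-L_U*)γ)' = 0 when U' = u, so it stays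
in one orbit. A smooth choice of u near a point comes from `Frame.lift`. Connectedness then puts an
entire integral manifold meeting an orbit inside it (`range_incl_subset`), openly and smoothly
(`isLeaf_orbitManifold`).

For the metric, let a_v(x) in A satisfy L_{a_v}*μ_x = ι v at the orbit point μ_x with coordinate x.
Then g(v,w) = μ_x(a_v a_w). Differentiating the constant function x ↦ μ_x(a_v(x) c) expresses the
derivative of a_v through products, and Dg(z,v,w) = -μ_x(a_z a_v a_w). Total symmetry gives a local
potential by two uses of the Poincaré lemma; one more derivative involves only products of four
elements, so it vanishes if A⁴ = 0. -/

set_option maxSynthPendingDepth 3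

noncomputable section

namespace PseudoHessian

/-! ### Manifolds with a global chart -/

section GlobalChart

variable {E : Type*} [NormedAddCommGroup E] [NormedSpace ℝ E]
  {M : Type*} [TopologicalSpace M] [ChartedSpace E M]
  {G : Type*} [NormedAddCommGroup G] [NormedSpace ℝ G]

variable {e : OpenPartialHomeomorph M E} (he : ∀ x : M, chartAt E x = e)

include he

omit [NormedSpace ℝ E] in
lemma globalChart_mem_source (x : M) : x ∈ e.source := he x ▸ mem_chart_source E x

omit [NormedSpace ℝ E] in
lemma globalChart_left_inv (x : M) : e.symm (e x) = x :=
  e.left_inv (globalChart_mem_source he x)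

omit [NormedSpace ℝ E] in
lemma globalChart_mem_target (x : M) : e x ∈ e.target :=
  e.map_source (globalChart_mem_source he x)

omit [NormedSpace ℝ E] in
lemma globalChart_target_mem_nhds (x : M) : e.target ∈ 𝓝 (e x) :=
  e.open_target.mem_nhds (globalChart_mem_target he x)

omit [NormedSpace ℝ E] in
lemma globalChart_comp_symm_comp {β : Type*} (F : M → β) : (F ∘ e.symm) ∘ e = F := by
  ext x; simp [globalChart_left_inv he]

lemma mdifferentiableAt_iff_globalChart {F : M → G} {x : M} :
    MDifferentiableAt 𝓘(ℝ, E) 𝓘(ℝ, G) F x ↔ DifferentiableAt ℝ (F ∘ e.symm) (e x) := by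
  rw [mdifferentiableAt_iff]
  simp only [writtenInExtChartAt, extChartAt, he, mfld_simps, differentiableWithinAt_univ]
  refine and_iff_right_of_imp fun h => ?_
  have h1 : ContinuousAt ((F ∘ e.symm) ∘ e) x :=
    ContinuousAt.comp h.continuousAt (e.continuousAt (globalChart_mem_source he x))
  rwa [globalChart_comp_symm_comp he] at h1

lemma mfderiv_eq_globalChart {F : M → G} {x : M} :
    mfderiv 𝓘(ℝ, E) 𝓘(ℝ, G) F x = fderiv ℝ (F ∘ e.symm) (e x) := by
  by_cases h : MDifferentiableAt 𝓘(ℝ, E) 𝓘(ℝ, G) F x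
  · rw [h.mfderiv]
    simp only [writtenInExtChartAt, extChartAt, he, mfld_simps, fderivWithin_univ]
    rfl
  · rw [mfderiv_zero_of_not_mdifferentiableAt h,
      fderiv_zero_of_not_differentiableAt (mt (mdifferentiableAt_iff_globalChart he).2 h)]
    rfl

lemma mvfderiv_eq_globalChart {F : M → G} {x : M} :
    mvfderiv 𝓘(ℝ, E) F x = fderiv ℝ (F ∘ e.symm) (e x) := by
  have := mfderiv_eq_globalChart he (F := F) (x := x)
  exact this

lemma contMDiffAt_iff_globalChart {n : ℕ∞ω} {F : M → G} {x : M} :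
    ContMDiffAt 𝓘(ℝ, E) 𝓘(ℝ, G) n F x ↔ ContDiffAt ℝ n (F ∘ e.symm) (e x) := by
  rw [contMDiffAt_iff]
  simp only [extChartAt, he, mfld_simps, contDiffWithinAt_univ]
  refine and_iff_right_of_imp fun h => ?_
  have h1 : ContinuousAt ((F ∘ e.symm) ∘ e) x :=
    ContinuousAt.comp h.continuousAt (e.continuousAt (globalChart_mem_source he x))
  rwa [globalChart_comp_symm_comp he] at h1

variable [IsManifold 𝓘(ℝ, E) ∞ M]

/-- There is only one chart, so every coordinate change of the tangent bundle is the identity. This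
is what lets vector fields, one-forms and endomorphism fields be read as plain functions on the
model space. -/
lemma coordChange_globalChart (x y z : M) (hz : z ∈ (chartAt E x).source) (v : E) :
    (tangentBundleCore 𝓘(ℝ, E) M).coordChange (achart E x) (achart E y) z v = v := by
  have h : achart E y = achart E x := Subtype.ext (by simp [he])
  rw [h]
  exact (tangentBundleCore 𝓘(ℝ, E) M).coordChange_self _ _ hz _

lemma trivializationAt_globalChart (x y : M) (v : TangentSpace 𝓘(ℝ, E) y) :
    (trivializationAt E (TangentSpace 𝓘(ℝ, E) : M → Type _) x ⟨y, v⟩).2 = v :=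
  coordChange_globalChart he y x y (mem_chart_source E y) v

lemma contMDiffAt_vField_iff_globalChart {n : ℕ∞ω} {X : VField E M} {x : M} :
    ContMDiffAt 𝓘(ℝ, E) (𝓘(ℝ, E).prod 𝓘(ℝ, E)) n
      (fun x => (⟨x, X x⟩ : TotalSpace E (TangentSpace 𝓘(ℝ, E) : M → Type _))) x ↔
    ContDiffAt ℝ n (fun y => (X (e.symm y) : E)) (e x) := by
  rw [contMDiffAt_section]
  simp only [trivializationAt_globalChart he]
  exact contMDiffAt_iff_globalChart (G := E) he (F := X)

lemma vField_smooth_iff_globalChart {X : VField E M} :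
    X.Smooth ↔ ∀ x, ContDiffAt ℝ ∞ (fun y => (X (e.symm y) : E)) (e x) :=
  forall_congr' fun _ => contMDiffAt_vField_iff_globalChart he

lemma mdifferentiableAt_vField_iff_globalChart {X : VField E M} {x : M} :
    MDiffAt (T% X) x ↔ DifferentiableAt ℝ (fun y => (X (e.symm y) : E)) (e x) := by
  rw [mdifferentiableAt_section]
  simp only [trivializationAt_globalChart he]
  exact mdifferentiableAt_iff_globalChart (G := E) he (F := X)

lemma symmL_globalChart (x y : M) (v : E) :
    (trivializationAt E (TangentSpace 𝓘(ℝ, E) : M → Type _) x).symmL ℝ y v = v := by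
  have hy : y ∈ (chartAt E x).source := by rw [he]; exact globalChart_mem_source he y
  rw [TangentBundle.symmL_trivializationAt_eq_core hy]
  exact coordChange_globalChart he x y y hy v

lemma continuousLinearMapAt_globalChart (x y : M) (v : E) :
    (trivializationAt E (TangentSpace 𝓘(ℝ, E) : M → Type _) x).continuousLinearMapAt ℝ y v = v := by
  have hy : y ∈ (chartAt E x).source := by rw [he]; exact globalChart_mem_source he y
  rw [TangentBundle.continuousLinearMapAt_trivializationAt_eq_core hy]
  exact coordChange_globalChart he y x y (mem_chart_source E y) v

lemma contMDiffAt_endField_iff_globalChart {n : ℕ∞ω}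
    {B : Π x : M, TangentSpace 𝓘(ℝ, E) x →L[ℝ] TangentSpace 𝓘(ℝ, E) x} {x : M} :
    ContMDiffAt 𝓘(ℝ, E) (𝓘(ℝ, E).prod 𝓘(ℝ, E →L[ℝ] E)) n
      (fun x => (⟨x, B x⟩ : TotalSpace (E →L[ℝ] E)
        (fun x : M => TangentSpace 𝓘(ℝ, E) x →L[ℝ] TangentSpace 𝓘(ℝ, E) x))) x ↔
    ContDiffAt ℝ n (F := E →L[ℝ] E) (fun y => B (e.symm y)) (e x) := by
  rw [contMDiffAt_hom_bundle]
  have h (y : M) : ContinuousLinearMap.inCoordinates E (TangentSpace 𝓘(ℝ, E) : M → Type _) E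
      (TangentSpace 𝓘(ℝ, E) : M → Type _) x y x y (B y) = (B y : E →L[ℝ] E) := by
    ext v
    simp only [ContinuousLinearMap.inCoordinates, ContinuousLinearMap.comp_apply]
    rw [symmL_globalChart he]
    exact continuousLinearMapAt_globalChart he x y _
  simp only [h]
  refine (and_iff_right contMDiffAt_id).trans ?_
  exact contMDiffAt_iff_globalChart (G := E →L[ℝ] E) he (F := B)

omit he in
lemma inCoordinates_trivial (x y : M) (α : TangentSpace 𝓘(ℝ, E) y →L[ℝ] ℝ) (v : E) :
    ContinuousLinearMap.inCoordinates E (TangentSpace 𝓘(ℝ, E) : M → Type _) ℝ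
      (Bundle.Trivial M ℝ) x y x y α v =
      α ((trivializationAt E (TangentSpace 𝓘(ℝ, E) : M → Type _) x).symmL ℝ y v) := by
  simp [ContinuousLinearMap.inCoordinates]

lemma inCoordinates_oForm_globalChart (x y : M) (α : TangentSpace 𝓘(ℝ, E) y →L[ℝ] ℝ) :
    ContinuousLinearMap.inCoordinates E (TangentSpace 𝓘(ℝ, E) : M → Type _) ℝ
      (Bundle.Trivial M ℝ) x y x y α = (α : E →L[ℝ] ℝ) := by
  ext v
  rw [inCoordinates_trivial, symmL_globalChart he]
  rfl

lemma contMDiffAt_oForm_iff_globalChart {n : ℕ∞ω} {α : OForm E M} {x : M} :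
    ContMDiffAt 𝓘(ℝ, E) (𝓘(ℝ, E).prod 𝓘(ℝ, E →L[ℝ] ℝ)) n α.toSection x ↔
    ContDiffAt ℝ n (F := E →L[ℝ] ℝ) (fun y => α (e.symm y)) (e x) := by
  have := contMDiffAt_hom_bundle (n := n) (IM := 𝓘(ℝ, E)) (IB := 𝓘(ℝ, E)) (E₁ := (TangentSpace 𝓘(ℝ, E) : M → Type _))
    (E₂ := Bundle.Trivial M ℝ) α.toSection (x₀ := x)
  rw [this]
  simp only [inCoordinates_oForm_globalChart he]
  refine (and_iff_right contMDiffAt_id).trans ?_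
  exact contMDiffAt_iff_globalChart (G := E →L[ℝ] ℝ) he (F := α)

lemma mdifferentiableAt_oForm_iff_globalChart {α : OForm E M} {x : M} :
    MDifferentiableAt 𝓘(ℝ, E) (𝓘(ℝ, E).prod 𝓘(ℝ, E →L[ℝ] ℝ)) α.toSection x ↔
    DifferentiableAt ℝ (F := E →L[ℝ] ℝ) (fun y => α (e.symm y)) (e x) := by
  have := mdifferentiableAt_hom_bundle (IM := 𝓘(ℝ, E)) (IB := 𝓘(ℝ, E)) (E₁ := (TangentSpace 𝓘(ℝ, E) : M → Type _))
    (E₂ := Bundle.Trivial M ℝ) α.toSection (x₀ := x)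
  rw [this]
  simp only [inCoordinates_oForm_globalChart he]
  refine (and_iff_right mdifferentiableAt_id).trans ?_
  exact mdifferentiableAt_iff_globalChart (G := E →L[ℝ] ℝ) he (F := α)

end GlobalChart

/-! ### Lie brackets and the flat connection in a global chart. -/

section GlobalChartConnection

variable {E : Type*} [NormedAddCommGroup E] [NormedSpace ℝ E]
  {M : Type*} [TopologicalSpace M] [ChartedSpace E M]
  {G : Type*} [NormedAddCommGroup G] [NormedSpace ℝ G]

lemma mlieBracket_vectorSpace (V W : VField E E) :
    VectorField.mlieBracket 𝓘(ℝ, E) V W = VectorField.lieBracket ℝ (E := E) V W := by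
  rw [← VectorField.mlieBracketWithin_univ, VectorField.mlieBracketWithin_eq_lieBracketWithin]
  exact VectorField.lieBracketWithin_univ

variable {e : OpenPartialHomeomorph M E} (he : ∀ x : M, chartAt E x = e)

/-- A vector field on a manifold with a global chart, read in the chart. -/
def chartRep (e : OpenPartialHomeomorph M E) (X : VField E M) : E → E := fun y => X (e.symm y)

include he

lemma chartRep_apply (X : VField E M) (x : M) : chartRep e X (e x) = X x := by
  have h := globalChart_left_inv he x
  have : ∀ y, y = x → (X y : E) = X x := by rintro y rfl; rfl
  exact this _ h

variable [IsManifold 𝓘(ℝ, E) ∞ M]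

omit [IsManifold 𝓘(ℝ, E) ∞ M] in
lemma mfderiv_globalChart (x : M) :
    mfderiv 𝓘(ℝ, E) 𝓘(ℝ, E) e x = ContinuousLinearMap.id ℝ E := by
  have h : (e ∘ e.symm) =ᶠ[𝓝 (e x)] id := by
    filter_upwards [globalChart_target_mem_nhds he x] with y hy using e.right_inv hy
  rw [mfderiv_eq_globalChart he]
  exact h.fderiv_eq.trans fderiv_id

omit [IsManifold 𝓘(ℝ, E) ∞ M] in
lemma mpullback_globalChart (X : VField E M) :
    VectorField.mpullback 𝓘(ℝ, E) 𝓘(ℝ, E) e (chartRep e X) = X := by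
  ext x
  have h : VectorField.mpullback 𝓘(ℝ, E) 𝓘(ℝ, E) e (chartRep e X) x =
      (ContinuousLinearMap.inverse (ContinuousLinearMap.id ℝ E)) (chartRep e X (e x)) := by
    rw [← mfderiv_globalChart he x]
    rfl
  rw [h, ContinuousLinearMap.inverse_id]
  exact chartRep_apply he X x

omit [IsManifold 𝓘(ℝ, E) ∞ M] in
lemma contMDiff_globalChart (x : M) : ContMDiffAt 𝓘(ℝ, E) 𝓘(ℝ, E) ∞ e x := by
  rw [contMDiffAt_iff_globalChart he]
  have h : (e ∘ e.symm) =ᶠ[𝓝 (e x)] id := by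
    filter_upwards [globalChart_target_mem_nhds he x] with y hy using e.right_inv hy
  exact contDiffAt_id.congr_of_eventuallyEq h

lemma mdifferentiableAt_iff_chartRep {X : VField E M} {x : M} :
    MDiffAt (T% X) x ↔ DifferentiableAt ℝ (chartRep e X) (e x) :=
  mdifferentiableAt_vField_iff_globalChart he

lemma contMDiffAt_iff_chartRep {n : ℕ∞ω} {X : VField E M} {x : M} :
    ContMDiffAt 𝓘(ℝ, E) (𝓘(ℝ, E).prod 𝓘(ℝ, E)) n
      (fun x => (⟨x, X x⟩ : TotalSpace E (TangentSpace 𝓘(ℝ, E) : M → Type _))) x ↔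
    ContDiffAt ℝ n (chartRep e X) (e x) :=
  contMDiffAt_vField_iff_globalChart he

lemma VField.Smooth.contDiffAt_chartRep {X : VField E M} (hX : X.Smooth) (x : M) :
    ContDiffAt ℝ ∞ (chartRep e X) (e x) :=
  (contMDiffAt_iff_chartRep he).1 (hX x)

/-- Naturality of the bracket under pullback by the chart, whose derivative is the identity in these
trivialisations. -/
lemma mlieBracket_globalChart [CompleteSpace E] {X Y : VField E M} {x : M}
    (hX : DifferentiableAt ℝ (chartRep e X) (e x)) (hY : DifferentiableAt ℝ (chartRep e Y) (e x)) :
    VectorField.mlieBracket 𝓘(ℝ, E) X Y x =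
      VectorField.lieBracket ℝ (chartRep e X) (chartRep e Y) (e x) := by
  have : IsManifold 𝓘(ℝ, E) (minSmoothness ℝ 2) M := by
    rw [minSmoothness_of_isRCLikeNormedField]
    exact IsManifold.of_le (n := ∞) (ENat.LEInfty.out)
  have h := VectorField.mpullback_mlieBracket (I := 𝓘(ℝ, E)) (I' := 𝓘(ℝ, E)) (f := e) (x₀ := x)
    (V := chartRep e X) (W := chartRep e Y) (n := ∞)
    (mdifferentiableAt_vectorSpace_iff.2 hX) (mdifferentiableAt_vectorSpace_iff.2 hY)
    (contMDiff_globalChart he x)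
    (by rw [minSmoothness_of_isRCLikeNormedField]; exact ENat.LEInfty.out)
  rw [mpullback_globalChart he, mpullback_globalChart he] at h
  have h2 := mlieBracket_vectorSpace (chartRep e X) (chartRep e Y)
  refine h.symm.trans ?_
  rw [h2]
  have h1 : VectorField.mpullback 𝓘(ℝ, E) 𝓘(ℝ, E) e
      (VectorField.lieBracket ℝ (chartRep e X) (chartRep e Y)) x =
      (ContinuousLinearMap.inverse (ContinuousLinearMap.id ℝ E))
        (VectorField.lieBracket ℝ (chartRep e X) (chartRep e Y) (e x)) := by
    rw [← mfderiv_globalChart he x]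
    rfl
  rw [h1, ContinuousLinearMap.inverse_id]
  rfl

/-- The flat connection of a manifold with a global chart. -/
def flatConn : Conn E M where
  toFun Y x := (fderiv ℝ (chartRep e Y) (e x) : E →L[ℝ] E)
  isCovariantDerivativeOnUniv := by
    constructor
    · intro σ σ' x hσ hσ' _
      exact fderiv_add ((mdifferentiableAt_iff_chartRep he).1 hσ)
        ((mdifferentiableAt_iff_chartRep he).1 hσ')
    · intro σ g x hσ hg _
      have h1 := (mdifferentiableAt_iff_chartRep he).1 hσ
      have h2 := (mdifferentiableAt_iff_globalChart he).1 hg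
      have h3 := fderiv_smul h2 h1
      have h4 : mvfderiv 𝓘(ℝ, E) g x = fderiv ℝ (g ∘ e.symm) (e x) := mvfderiv_eq_globalChart he
      rw [h4]
      rw [chartRep_apply he, Function.comp_apply, globalChart_left_inv he] at h3
      exact h3

variable {cov : Conn E M} (hcov : ∀ Y x, cov Y x = fderiv ℝ (chartRep e Y) (e x))

include hcov

lemma chartRep_cov {Y Z : VField E M} (x : M) :
    chartRep e (fun y => cov Z y (Y y)) =ᶠ[𝓝 (e x)]
      fun z => fderiv ℝ (chartRep e Z) z (chartRep e Y z) := by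
  filter_upwards [globalChart_target_mem_nhds he x] with z hz
  change cov Z (e.symm z) (Y (e.symm z)) = _
  rw [hcov, e.right_inv hz]
  rfl

/-- In the chart the connection is the ordinary derivative. Vanishing torsion is then the coordinate
formula for the bracket. In the curvature the first-order terms combine into DZ applied to the
bracket, and the second derivatives of Z cancel by symmetry. -/
lemma isAffine_of_globalChart [FiniteDimensional ℝ E] : IsAffine cov where
  smooth := ⟨⟨by
    intro σ hσ x _
    refine ContMDiffAt.contMDiffWithinAt ?_
    have h1 : ContDiffAt ℝ (∞ + 1) (chartRep e σ) (e x) :=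
      (contMDiffAt_iff_chartRep he).1 (contMDiffOn_univ.1 hσ x)
    rw [contMDiffAt_endField_iff_globalChart he]
    refine (h1.fderiv_right le_rfl).congr_of_eventuallyEq ?_
    filter_upwards [globalChart_target_mem_nhds he x] with z hz
    have := hcov σ (e.symm z)
    rw [e.right_inv hz] at this
    exact this⟩⟩
  torsionless := by
    rw [CovariantDerivative.torsion_eq_zero_iff]
    intro X Y x hX hY
    rw [mlieBracket_globalChart he ((mdifferentiableAt_iff_chartRep he).1 hX)
      ((mdifferentiableAt_iff_chartRep he).1 hY), hcov, hcov, VectorField.lieBracket,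
      chartRep_apply he, chartRep_apply he]
    rfl
  flat := by
    intro X Y Z hX hY hZ x
    have hX1 := hX.contDiffAt_chartRep he x
    have hY1 := hY.contDiffAt_chartRep he x
    have hZ1 := hZ.contDiffAt_chartRep he x
    have hX2 := hX1.differentiableAt (by simp)
    have hY2 := hY1.differentiableAt (by simp)
    have hZ2 : DifferentiableAt ℝ (fderiv ℝ (chartRep e Z)) (e x) :=
      (hZ1.fderiv_right (m := ∞) (by simp)).differentiableAt (by simp)
    have hsymm := hZ1.isSymmSndFDerivAt
      (by rw [minSmoothness_of_isRCLikeNormedField]; exact ENat.LEInfty.out)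
    rw [mlieBracket_globalChart he hX2 hY2, hcov, hcov, hcov,
      (chartRep_cov he hcov x).fderiv_eq, (chartRep_cov he hcov x).fderiv_eq,
      fderiv_clm_apply hZ2 hY2, fderiv_clm_apply hZ2 hX2, VectorField.lieBracket,
      ← chartRep_apply he X, ← chartRep_apply he Y]
    have h := hsymm (chartRep e X (e x)) (chartRep e Y (e x))
    have key : ∀ (A B : E →L[ℝ] E) (D : E →L[ℝ] E) (D2 : E →L[ℝ] E →L[ℝ] E) (a b : E),
        D2 a b = D2 b a →
        (D.comp A + D2.flip b) a - (D.comp B + D2.flip a) b - D (A a - B b) = 0 := by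
      intro A B D D2 a b h
      simp [h]
    exact key _ _ _ _ _ _ h

end GlobalChartConnection

/-! ### The generalized pseudo-Hessian structure of the dual of a commutative algebra -/

section Pairing

variable {A : Type*} [NormedAddCommGroup A] [NormedSpace ℝ A]
  {E : Type*} [NormedAddCommGroup E] [NormedSpace ℝ E]

lemma contDiffAt_pairing {n : ℕ∞ω} {μ : E → DualSpace A} {m : E → A} {x : E}
    (hμ : ContDiffAt ℝ n μ x) (hm : ContDiffAt ℝ n m x) :
    ContDiffAt ℝ n (fun y => μ y (m y)) x :=
  ContDiffAt.clm_apply (F := A) (G := ℝ) (f := μ) hμ hm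

lemma fderiv_pairing {μ : E → DualSpace A} {m : E → A} {x : E}
    (hμ : DifferentiableAt ℝ μ x) (hm : DifferentiableAt ℝ m x) (v : E) :
    fderiv ℝ (fun y => μ y (m y)) x v = fderiv ℝ μ x v (m x) + μ x (fderiv ℝ m x v) := by
  have h := fderiv_clm_apply (G := A) (H := ℝ) (c := μ) (u := m) hμ hm
  have h2 := congrArg (fun L : E →L[ℝ] ℝ => L v) h
  refine h2.trans ?_
  rw [add_comm]
  rfl

variable [FiniteDimensional ℝ A] (mul : A →ₗ[ℝ] A →ₗ[ℝ] A)

lemma contDiffAt_mul {n : ℕ∞ω} {a b : E → A} {x : E}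
    (ha : ContDiffAt ℝ n a x) (hb : ContDiffAt ℝ n b x) :
    ContDiffAt ℝ n (fun y => mul (a y) (b y)) x :=
  ((LinearMap.toContinuousBilinearMap mul).contDiff.contDiffAt.comp x ha).clm_apply hb

lemma hasFDerivAt_mul {a b : E → A} {x : E}
    (ha : DifferentiableAt ℝ a x) (hb : DifferentiableAt ℝ b x) :
    HasFDerivAt (fun y => mul (a y) (b y))
      ((LinearMap.toContinuousBilinearMap mul).precompR E (a x) (fderiv ℝ b x) +
        (LinearMap.toContinuousBilinearMap mul).precompL E (fderiv ℝ a x) (b x)) x :=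
  (LinearMap.toContinuousBilinearMap mul).hasFDerivAt_of_bilinear ha.hasFDerivAt hb.hasFDerivAt

lemma differentiableAt_mul {a b : E → A} {x : E}
    (ha : DifferentiableAt ℝ a x) (hb : DifferentiableAt ℝ b x) :
    DifferentiableAt ℝ (fun y => mul (a y) (b y)) x :=
  (hasFDerivAt_mul mul ha hb).differentiableAt

lemma fderiv_mul_apply {a b : E → A} {x : E}
    (ha : DifferentiableAt ℝ a x) (hb : DifferentiableAt ℝ b x) (v : E) :
    fderiv ℝ (fun y => mul (a y) (b y)) x v =
      mul (a x) (fderiv ℝ b x v) + mul (fderiv ℝ a x v) (b x) := by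
  rw [(hasFDerivAt_mul mul ha hb).fderiv]
  simp

omit [FiniteDimensional ℝ A] in
lemma DualSpace.ext_apply {μ ν : DualSpace A} (h : ∀ a, μ a = ν a) : μ = ν :=
  DFunLike.ext _ _ h

lemma eq_zero_of_forall_dualSpace {a : A} (h : ∀ μ : DualSpace A, μ a = 0) : a = 0 := by
  apply (toBidual A).injective
  ext μ
  simpa [toBidual_apply] using h μ

end Pairing

/-! ### One-forms as A-valued functions, and the formulas for T and 𝓓. -/

section Algebra

variable {A : Type*} [NormedAddCommGroup A] [NormedSpace ℝ A] [FiniteDimensional ℝ A]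
  (mul : A →ₗ[ℝ] A →ₗ[ℝ] A)

/-- An `A`-valued function on `A*`, viewed as a one-form. -/
def formOf (a : DualSpace A → A) : OForm (DualSpace A) (DualSpace A) := fun μ => toBidual A (a μ)

lemma exists_formOf (α : OForm (DualSpace A) (DualSpace A)) : ∃ a, α = formOf a :=
  ⟨fun μ => (toBidual A).symm (α μ), by
    ext μ : 1
    exact ((toBidual A).apply_symm_apply _).symm⟩

lemma globalChart_vectorSpace (V : Type*) [TopologicalSpace V] (x : V) :
    chartAt V x = OpenPartialHomeomorph.refl V := chartAt_self_eq

lemma contDiffAt_toBidual_iff {E : Type*} [NormedAddCommGroup E] [NormedSpace ℝ E] {n : ℕ∞ω}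
    {a : E → A} {x : E} : ContDiffAt ℝ n (fun y => toBidual A (a y)) x ↔ ContDiffAt ℝ n a x :=
  (toBidual A).toContinuousLinearEquiv.comp_contDiffAt_iff

lemma differentiableAt_toBidual_iff {E : Type*} [NormedAddCommGroup E] [NormedSpace ℝ E]
    {a : E → A} {x : E} :
    DifferentiableAt ℝ (fun y => toBidual A (a y)) x ↔ DifferentiableAt ℝ a x :=
  (toBidual A).toContinuousLinearEquiv.comp_differentiableAt_iff

lemma formOf_smooth_iff {a : DualSpace A → A} : (formOf a).Smooth ↔ ContDiff ℝ ∞ a := by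
  rw [contDiff_iff_contDiffAt]
  refine forall_congr' fun μ => ?_
  rw [contMDiffAt_oForm_iff_globalChart (globalChart_vectorSpace (DualSpace A))]
  exact contDiffAt_toBidual_iff

lemma formOf_mdifferentiableAt_iff {a : DualSpace A → A} {μ : DualSpace A} :
    MDifferentiableAt 𝓘(ℝ, DualSpace A) (𝓘(ℝ, DualSpace A).prod 𝓘(ℝ, DualSpace A →L[ℝ] ℝ))
      (formOf a).toSection μ ↔ DifferentiableAt ℝ a μ := by
  rw [mdifferentiableAt_oForm_iff_globalChart (globalChart_vectorSpace (DualSpace A))]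
  exact differentiableAt_toBidual_iff

lemma mvfderiv_vectorSpace {V : Type*} [NormedAddCommGroup V] [NormedSpace ℝ V] (f : V → ℝ)
    (x v : V) : mvfderiv 𝓘(ℝ, V) f x v = fderiv ℝ f x v :=
  congrArg (fun L : V →L[ℝ] ℝ => L v) (mvfderiv_eq_globalChart (globalChart_vectorSpace V))

lemma dualCov_formOf {a : DualSpace A → A} {μ : DualSpace A} (ha : DifferentiableAt ℝ a μ)
    (v : DualSpace A) :
    dualCov (canonicalConn (DualSpace A)) (formOf a) μ v = toBidual A (fderiv ℝ a μ v) := by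
  refine ContinuousLinearMap.ext fun (w : DualSpace A) => ?_
  -- A constant field is parallel, so testing against it leaves only the derivative of the pairing.
  let Y : VField (DualSpace A) (DualSpace A) := fun _ => w
  have h := dualCov_apply (canonicalConn (DualSpace A)) (formOf_mdifferentiableAt_iff.2 ha)
    (Y := Y) (mdifferentiableAt_vectorSpace_iff.2 (differentiableAt_const w)) v
  refine h.trans ?_
  have h1 : canonicalConn (DualSpace A) Y μ v = 0 :=
    congrArg (fun L : DualSpace A →L[ℝ] DualSpace A => L v) (fderiv_const_apply w)
  rw [h1, map_zero, sub_zero]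
  refine (mvfderiv_vectorSpace _ μ v).trans ?_
  refine (fderiv_pairing (differentiableAt_const w) ha v).trans ?_
  rw [fderiv_const_apply]
  exact zero_add _

lemma dualBiv_formOf (a b : DualSpace A → A) (μ : DualSpace A) :
    dualBiv mul μ (formOf a μ) (formOf b μ) = μ (mul (a μ) (b μ)) :=
  dualBiv_apply mul μ _ _

lemma sharp_dualBiv (μ : DualSpace A) (a : A) :
    sharp (dualBiv mul) μ (toBidual A a) = mulTranspose mul a μ := by
  refine DualSpace.ext_apply fun b => ?_
  have h := apply_sharp (dualBiv mul) μ (toBidual A a) (toBidual A b)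
  exact h.trans (dualBiv_apply mul μ a b)

lemma sharp_formOf (a : DualSpace A → A) (μ : DualSpace A) :
    sharp (dualBiv mul) μ (formOf a μ) = mulTranspose mul (a μ) μ :=
  sharp_dualBiv mul μ (a μ)

/-- The product rule for μ(bc) has three terms; those differentiating b and c are removed by the
dual connection, and the one differentiating the base point μ remains. -/
lemma nablaBiv_formOf {b c : DualSpace A → A} {μ : DualSpace A}
    (hb : DifferentiableAt ℝ b μ) (hc : DifferentiableAt ℝ c μ) (v : DualSpace A) :
    nablaBiv (canonicalConn (DualSpace A)) (dualBiv mul) (formOf b) (formOf c) μ v =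
      v (mul (b μ) (c μ)) := by
  have h1 : mvfderiv 𝓘(ℝ, DualSpace A)
      (fun y => dualBiv mul y (formOf b y) (formOf c y)) μ v =
      v (mul (b μ) (c μ)) + (μ (mul (b μ) (fderiv ℝ c μ v)) + μ (mul (fderiv ℝ b μ v) (c μ))) := by
    refine (mvfderiv_vectorSpace _ μ v).trans ?_
    simp only [dualBiv_formOf]
    rw [fderiv_pairing (μ := fun y => y) differentiableAt_id (differentiableAt_mul mul hb hc),
      fderiv_mul_apply mul hb hc, map_add]
    have : fderiv ℝ (fun y : DualSpace A => y) μ v = v := by rw [fderiv_fun_id]; rfl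
    rw [this]
  have h2 : dualBiv mul μ (dualCov (canonicalConn (DualSpace A)) (formOf b) μ v) (formOf c μ) =
      μ (mul (fderiv ℝ b μ v) (c μ)) := by
    rw [dualCov_formOf hb]; exact dualBiv_apply mul μ _ _
  have h3 : dualBiv mul μ (formOf b μ) (dualCov (canonicalConn (DualSpace A)) (formOf c) μ v) =
      μ (mul (b μ) (fderiv ℝ c μ v)) := by
    rw [dualCov_formOf hc]; exact dualBiv_apply mul μ _ _
  have h4 : nablaBiv (canonicalConn (DualSpace A)) (dualBiv mul) (formOf b) (formOf c) μ v =
      mvfderiv 𝓘(ℝ, DualSpace A) (fun y => dualBiv mul y (formOf b y) (formOf c y)) μ v -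
      dualBiv mul μ (dualCov (canonicalConn (DualSpace A)) (formOf b) μ v) (formOf c μ) -
      dualBiv mul μ (formOf b μ) (dualCov (canonicalConn (DualSpace A)) (formOf c) μ v) := rfl
  rw [h4, h1, h2, h3]
  ring

lemma tensorT_formOf {a b c : DualSpace A → A} {μ : DualSpace A}
    (hb : DifferentiableAt ℝ b μ) (hc : DifferentiableAt ℝ c μ) :
    tensorT (canonicalConn (DualSpace A)) (dualBiv mul) (formOf a) (formOf b) (formOf c) μ =
      μ (mul (a μ) (mul (b μ) (c μ))) := by
  rw [tensorT, sharp_formOf]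
  exact nablaBiv_formOf mul hb hc _

lemma anchoredProd_formOf {a b : DualSpace A → A}
    (ha : Differentiable ℝ a) (hb : Differentiable ℝ b) :
    anchoredProd (canonicalConn (DualSpace A)) (dualBiv mul) (formOf a) (formOf b) =
      formOf fun μ => mul (a μ) (b μ) + fderiv ℝ b μ (mulTranspose mul (a μ) μ) := by
  ext μ : 1
  refine ContinuousLinearMap.ext fun (v : DualSpace A) => ?_
  have h2 := dualCov_formOf (hb μ) (mulTranspose mul (a μ) μ)
  rw [← sharp_formOf] at h2
  have h3 := congrArg (fun L : DualSpace A →L[ℝ] ℝ => L v) h2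
  have h4 := congrArg₂ (· + ·) (nablaBiv_formOf mul (ha μ) (hb μ) v) h3
  refine h4.trans ?_
  rw [sharp_formOf]
  exact (map_add v _ _).symm

variable (mul_comm : ∀ a b, mul a b = mul b a)
    (mul_assoc : ∀ a b c, mul (mul a b) c = mul a (mul b c))

/-- The linear map `u ↦ L_u*`. -/
def mulTransposeL : A →L[ℝ] DualSpace A →L[ℝ] DualSpace A :=
  (ContinuousLinearMap.compL ℝ A A ℝ).flip.comp (LinearMap.toContinuousBilinearMap mul)

lemma contDiff_mulTranspose_apply {a : DualSpace A → A} (ha : ContDiff ℝ ∞ a) :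
    ContDiff ℝ ∞ fun μ => mulTranspose mul (a μ) μ := by
  have h : ContDiff ℝ ∞ fun p : A × DualSpace A => mulTranspose mul p.1 p.2 := by
    exact ((mulTransposeL mul).contDiff.comp contDiff_fst).clm_apply contDiff_snd
  exact h.comp (ha.prodMk contDiff_id)

lemma contDiff_anchoredProd {a b : DualSpace A → A} (ha : ContDiff ℝ ∞ a) (hb : ContDiff ℝ ∞ b) :
    ContDiff ℝ ∞ fun μ => mul (a μ) (b μ) + fderiv ℝ b μ (mulTranspose mul (a μ) μ) := by
  refine ContDiff.add (contDiff_iff_contDiffAt.2 fun μ =>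
    contDiffAt_mul mul ha.contDiffAt hb.contDiffAt) ?_
  exact (hb.fderiv_right (m := ∞) (by simp)).clm_apply (contDiff_mulTranspose_apply mul ha)

include mul_comm mul_assoc

omit [FiniteDimensional ℝ A] in
lemma mul_left_comm_of (a b c : A) : mul a (mul b c) = mul b (mul a c) := by
  rw [← mul_assoc, mul_comm a b, mul_assoc]

lemma isGenPseudoHessian_dualBiv :
    IsGenPseudoHessian (canonicalConn (DualSpace A)) (dualBiv mul) where
  affine := isAffine_of_globalChart (globalChart_vectorSpace (DualSpace A)) fun _ _ => rfl
  bivector :=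
    { smooth := by
        intro α β hα hβ
        obtain ⟨a, rfl⟩ := exists_formOf α
        obtain ⟨b, rfl⟩ := exists_formOf β
        rw [formOf_smooth_iff] at hα hβ
        simp only [dualBiv_formOf]
        refine ContDiff.contMDiff (contDiff_iff_contDiffAt.2 fun μ => ?_)
        exact contDiffAt_pairing contDiffAt_id
          (contDiffAt_mul mul hα.contDiffAt hβ.contDiffAt)
      symm := by
        intro μ α β
        obtain ⟨a, rfl⟩ := (toBidual A).surjective α
        obtain ⟨b, rfl⟩ := (toBidual A).surjective β
        exact (dualBiv_apply mul μ a b).trans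
          ((congrArg μ (mul_comm a b)).trans (dualBiv_apply mul μ b a).symm) }
  codazzi := by
    intro α β γ hα hβ hγ μ
    obtain ⟨a, rfl⟩ := exists_formOf α
    obtain ⟨b, rfl⟩ := exists_formOf β
    obtain ⟨c, rfl⟩ := exists_formOf γ
    rw [formOf_smooth_iff] at hα hβ hγ
    have ha := hα.differentiable (by simp) μ
    have hb := hβ.differentiable (by simp) μ
    have hc := hγ.differentiable (by simp) μ
    rw [tensorT_formOf mul hb hc, tensorT_formOf mul ha hc,
      mul_left_comm_of mul mul_comm mul_assoc]

/-- The derivative of T along L_d*μ contributes μ(dabc) once from the base point, and each of the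
three 𝓓-terms subtracts it once, whence the factor -2. The derivatives of the coefficients a, b, c
cancel. -/
lemma parallel_formOf {d a b c : DualSpace A → A} (hd : ContDiff ℝ ∞ d) (ha : ContDiff ℝ ∞ a)
    (hb : ContDiff ℝ ∞ b) (hc : ContDiff ℝ ∞ c) (μ : DualSpace A) :
    mvfderiv 𝓘(ℝ, DualSpace A) (tensorT (canonicalConn (DualSpace A)) (dualBiv mul)
        (formOf a) (formOf b) (formOf c)) μ (sharp (dualBiv mul) μ (formOf d μ))
      - tensorT (canonicalConn (DualSpace A)) (dualBiv mul)
        (anchoredProd (canonicalConn (DualSpace A)) (dualBiv mul) (formOf d) (formOf a))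
        (formOf b) (formOf c) μ
      - tensorT (canonicalConn (DualSpace A)) (dualBiv mul) (formOf a)
        (anchoredProd (canonicalConn (DualSpace A)) (dualBiv mul) (formOf d) (formOf b))
        (formOf c) μ
      - tensorT (canonicalConn (DualSpace A)) (dualBiv mul) (formOf a) (formOf b)
        (anchoredProd (canonicalConn (DualSpace A)) (dualBiv mul) (formOf d) (formOf c)) μ =
      -2 * μ (mul (d μ) (mul (a μ) (mul (b μ) (c μ)))) := by
  have hd1 := hd.differentiable (by simp)
  have ha1 := ha.differentiable (by simp)
  have hb1 := hb.differentiable (by simp)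
  have hc1 := hc.differentiable (by simp)
  have hbc := differentiableAt_mul mul (hb1 μ) (hc1 μ)
  have h1 : tensorT (canonicalConn (DualSpace A)) (dualBiv mul) (formOf a) (formOf b) (formOf c) =
      fun μ => μ (mul (a μ) (mul (b μ) (c μ))) := by
    ext ν
    exact tensorT_formOf mul (hb1 ν) (hc1 ν)
  have h2 : mvfderiv 𝓘(ℝ, DualSpace A) (fun μ => μ (mul (a μ) (mul (b μ) (c μ)))) μ
      (mulTranspose mul (d μ) μ) =
      fderiv ℝ (fun y : DualSpace A => y) μ (mulTranspose mul (d μ) μ)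
        (mul (a μ) (mul (b μ) (c μ))) +
      μ (fderiv ℝ (fun y => mul (a y) (mul (b y) (c y))) μ (mulTranspose mul (d μ) μ)) := by
    refine (mvfderiv_vectorSpace _ μ _).trans ?_
    exact fderiv_pairing (μ := fun y => y) differentiableAt_id
      (differentiableAt_mul mul (ha1 μ) hbc) _
  have h3 : fderiv ℝ (fun y : DualSpace A => y) μ (mulTranspose mul (d μ) μ) =
    mulTranspose mul (d μ) μ := by rw [fderiv_fun_id]; rfl
  rw [h1, sharp_formOf, h2, h3, anchoredProd_formOf mul hd1 ha1, anchoredProd_formOf mul hd1 hb1,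
    anchoredProd_formOf mul hd1 hc1, tensorT_formOf mul (hb1 μ) (hc1 μ),
    tensorT_formOf mul ((contDiff_anchoredProd mul hd hb).differentiable (by simp) μ) (hc1 μ),
    tensorT_formOf mul (hb1 μ) ((contDiff_anchoredProd mul hd hc).differentiable (by simp) μ),
    fderiv_mul_apply mul (ha1 μ) hbc, fderiv_mul_apply mul (hb1 μ) (hc1 μ), mulTranspose_apply]
  simp only [map_add, LinearMap.add_apply, mul_assoc]
  have h4 (x y z w : A) : mul x (mul y (mul z w)) = mul y (mul x (mul z w)) :=
    mul_left_comm_of mul mul_comm mul_assoc _ _ _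
  rw [h4 (a μ) (d μ), mul_left_comm_of mul mul_comm mul_assoc (b μ) (d μ), h4 (a μ) (d μ)]
  ring

omit [FiniteDimensional ℝ A] mul_comm in
lemma fourthPower_eq_bot_iff :
    fourthPower mul = ⊥ ↔ ∀ a b c d, mul a (mul b (mul c d)) = 0 := by
  rw [fourthPower, Submodule.span_eq_bot]
  constructor
  · intro h a b c d
    exact h _ ⟨a, b, c, d, by simp only [mul_assoc]⟩
  · rintro h _ ⟨a, b, c, d, rfl⟩
    simp only [mul_assoc, h]

lemma isGenAffineSpecialReal_dualBiv_iff :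
    IsGenAffineSpecialReal (canonicalConn (DualSpace A)) (dualBiv mul) ↔ fourthPower mul = ⊥ := by
  rw [fourthPower_eq_bot_iff mul mul_assoc]
  constructor
  · intro h a b c d
    refine eq_zero_of_forall_dualSpace fun μ => ?_
    -- Constant forms already detect every product of four elements.
    have hs (a : A) : ContDiff ℝ ∞ (fun _ : DualSpace A => a) := contDiff_const
    have h1 := h.parallel _ _ _ _ (formOf_smooth_iff.2 (hs a)) (formOf_smooth_iff.2 (hs b))
      (formOf_smooth_iff.2 (hs c)) (formOf_smooth_iff.2 (hs d)) μ
    rw [parallel_formOf mul mul_comm mul_assoc (hs a) (hs b) (hs c) (hs d)] at h1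
    linarith
  · intro h
    refine ⟨isGenPseudoHessian_dualBiv mul mul_comm mul_assoc, ?_⟩
    intro δ α β γ hδ hα hβ hγ μ
    obtain ⟨d, rfl⟩ := exists_formOf δ
    obtain ⟨a, rfl⟩ := exists_formOf α
    obtain ⟨b, rfl⟩ := exists_formOf β
    obtain ⟨c, rfl⟩ := exists_formOf γ
    rw [formOf_smooth_iff] at hδ hα hβ hγ
    rw [parallel_formOf mul mul_comm mul_assoc hδ hα hβ hγ, h, map_zero, mul_zero]

end Algebra

/-! ### Hessian and special real metrics in a global affine chart. -/

section GlobalChartMetric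

variable {E : Type*} [NormedAddCommGroup E] [NormedSpace ℝ E] [FiniteDimensional ℝ E]
  {M : Type*} [TopologicalSpace M] [ChartedSpace E M] [IsManifold 𝓘(ℝ, E) ∞ M]

variable {e : OpenPartialHomeomorph M E} (he : ∀ x : M, chartAt E x = e)
  {cov : Conn E M} (hcov : ∀ Y x, cov Y x = fderiv ℝ (chartRep e Y) (e x))
  {g : BiForm E M} {G : E → E →L[ℝ] E →L[ℝ] ℝ} (hg : ∀ x, g x = G (e x))

omit [FiniteDimensional ℝ E] [IsManifold 𝓘(ℝ, E) ∞ M] in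
include he in
lemma mvfderiv_globalChart_apply {f : M → ℝ} {F : E → ℝ} {x : M} (h : f ∘ e.symm =ᶠ[𝓝 (e x)] F)
    (v : TangentSpace 𝓘(ℝ, E) x) : mvfderiv 𝓘(ℝ, E) f x v = fderiv ℝ F (e x) v := by
  have h1 := (mvfderiv_eq_globalChart he (F := f) (x := x)).trans h.fderiv_eq
  exact congrArg (fun L : E →L[ℝ] ℝ => L v) h1

omit [FiniteDimensional ℝ E] [IsManifold 𝓘(ℝ, E) ∞ M] in
include he hg in
lemma metric_chartRep (X Y : VField E M) (x : M) :
    (fun y => g y (X y) (Y y)) ∘ e.symm =ᶠ[𝓝 (e x)]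
      fun z => G z (chartRep e X z) (chartRep e Y z) := by
  filter_upwards [globalChart_target_mem_nhds he x] with z hz
  have h := hg (e.symm z)
  rw [e.right_inv hz] at h
  exact congrArg (fun B : E →L[ℝ] E →L[ℝ] ℝ => B (X (e.symm z)) (Y (e.symm z))) h

omit [FiniteDimensional ℝ E] in
lemma fderiv_bilin_apply {G : E → E →L[ℝ] E →L[ℝ] ℝ} {a b : E → E} {x : E}
    (hG : DifferentiableAt ℝ G x) (ha : DifferentiableAt ℝ a x) (hb : DifferentiableAt ℝ b x)
    (v : E) : fderiv ℝ (fun z => G z (a z) (b z)) x v =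
      fderiv ℝ G x v (a x) (b x) + G x (fderiv ℝ a x v) (b x) + G x (a x) (fderiv ℝ b x v) := by
  rw [fderiv_clm_apply (hG.clm_apply ha) hb, fderiv_clm_apply hG ha]
  simp
  ring

omit [FiniteDimensional ℝ E] in
lemma fderiv_trilin_apply {G : E → E →L[ℝ] E →L[ℝ] E →L[ℝ] ℝ} {a b c : E → E} {x : E}
    (hG : DifferentiableAt ℝ G x) (ha : DifferentiableAt ℝ a x) (hb : DifferentiableAt ℝ b x)
    (hc : DifferentiableAt ℝ c x) (v : E) : fderiv ℝ (fun z => G z (a z) (b z) (c z)) x v =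
      fderiv ℝ G x v (a x) (b x) (c x) + G x (fderiv ℝ a x v) (b x) (c x) +
        G x (a x) (fderiv ℝ b x v) (c x) + G x (a x) (b x) (fderiv ℝ c x v) := by
  rw [fderiv_clm_apply ((hG.clm_apply ha).clm_apply hb) hc, fderiv_clm_apply (hG.clm_apply ha) hb,
    fderiv_clm_apply hG ha]
  simp
  ring

omit [FiniteDimensional ℝ E] in
/-- A smooth field of symmetric bilinear forms with totally symmetric derivative is locally a
Hessian. -/
lemma exists_hessian_potential {Ω : Set E} (hΩ : IsOpen Ω)
    (hsmooth : ∀ y ∈ Ω, ContDiffAt ℝ ∞ G y) (hsymm : ∀ y ∈ Ω, ∀ v w, G y v w = G y w v)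
    (hcodazzi : ∀ y ∈ Ω, ∀ u v w, fderiv ℝ G y u v w = fderiv ℝ G y v u w)
    {y : E} (hy : y ∈ Ω) :
    ∃ B : Set E, IsOpen B ∧ y ∈ B ∧ B ⊆ Ω ∧ ∃ (φ : E → ℝ) (θ : E → E →L[ℝ] ℝ),
      ContDiffOn ℝ ∞ φ B ∧ (∀ z ∈ B, HasFDerivAt φ (θ z) z) ∧
      ∀ z ∈ B, HasFDerivAt θ (G z) z := by
  obtain ⟨r, hr, hB⟩ := Metric.isOpen_iff.1 hΩ y hy
  have hopen : IsOpen (Metric.ball y r) := Metric.isOpen_ball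
  -- The Poincaré lemma on a ball, used twice: the symmetry of DG in its first two slots gives G =
  -- Dθ, and the symmetry of G = Dθ gives θ = Dφ.
  obtain ⟨θ, hθ⟩ := (convex_ball y r).exists_forall_hasFDerivAt_of_fderiv_symmetric hopen
    (fun z hz => ((hsmooth z (hB hz)).differentiableAt (by simp)).differentiableWithinAt)
    (fun z hz u v => by ext w; exact hcodazzi z (hB hz) u v w)
  obtain ⟨φ, hφ⟩ := (convex_ball y r).exists_forall_hasFDerivAt_of_fderiv_symmetric hopen
    (fun z hz => (hθ z hz).differentiableAt.differentiableWithinAt)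
    (fun z hz u v => by rw [(hθ z hz).fderiv]; exact hsymm z (hB hz) u v)
  have hG : ContDiffOn ℝ ∞ G (Metric.ball y r) :=
    fun z hz => (hsmooth z (hB hz)).contDiffWithinAt
  have hθs : ContDiffOn ℝ ∞ θ (Metric.ball y r) := by
    rw [contDiffOn_infty_iff_fderiv_of_isOpen hopen]
    exact ⟨fun z hz => (hθ z hz).differentiableAt.differentiableWithinAt,
      hG.congr fun z hz => (hθ z hz).fderiv⟩
  have hφs : ContDiffOn ℝ ∞ φ (Metric.ball y r) := by
    rw [contDiffOn_infty_iff_fderiv_of_isOpen hopen]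
    exact ⟨fun z hz => (hφ z hz).differentiableAt.differentiableWithinAt,
      hθs.congr fun z hz => (hφ z hz).fderiv⟩
  exact ⟨Metric.ball y r, hopen, Metric.mem_ball_self hr, hB, φ, θ, hφs, hφ, hθ⟩

variable (hsmooth : ∀ y ∈ e.target, ContDiffAt ℝ ∞ G y)

include he hg hsmooth

omit [FiniteDimensional ℝ E] in
lemma contMDiff_metric {X Y : VField E M} (hX : X.Smooth) (hY : Y.Smooth) :
    ContMDiff 𝓘(ℝ, E) 𝓘(ℝ, ℝ) ∞ (fun x => g x (X x) (Y x)) := by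
  intro x
  rw [contMDiffAt_iff_globalChart he]
  refine ContDiffAt.congr_of_eventuallyEq ?_ (metric_chartRep he hg X Y x)
  exact ((hsmooth _ (globalChart_mem_target he x)).clm_apply
    (hX.contDiffAt_chartRep he x)).clm_apply (hY.contDiffAt_chartRep he x)

omit [FiniteDimensional ℝ E] in
lemma isPseudoRiemannian_of_globalChart (hsymm : ∀ y ∈ e.target, ∀ v w, G y v w = G y w v)
    (hnondeg : ∀ y ∈ e.target, ∀ v, (∀ w, G y v w = 0) → v = 0) : IsPseudoRiemannian g where
  smooth _ _ hX hY := contMDiff_metric he hg hsmooth hX hY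
  symm x v w := by
    rw [hg]
    exact hsymm _ (globalChart_mem_target he x) v w
  nondegenerate x v h := by
    rw [hg] at h
    exact hnondeg _ (globalChart_mem_target he x) v h

omit [FiniteDimensional ℝ E] in
include hcov in
-- The terms differentiating Y and Z are exactly the connection terms, so S is the coordinate
-- derivative of G.
lemma nablaMetric_globalChart {X Y Z : VField E M} {x : M}
    (hY : DifferentiableAt ℝ (chartRep e Y) (e x)) (hZ : DifferentiableAt ℝ (chartRep e Z) (e x)) :
    nablaMetric cov g X Y Z x = fderiv ℝ G (e x) (X x) (Y x) (Z x) := by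
  have hG := (hsmooth _ (globalChart_mem_target he x)).differentiableAt (by simp)
  have h1 := (mvfderiv_globalChart_apply he (metric_chartRep he hg Y Z x) (X x)).trans
    (fderiv_bilin_apply hG hY hZ _)
  rw [chartRep_apply he, chartRep_apply he] at h1
  rw [nablaMetric, h1, hg, hcov, hcov]
  have key : ∀ a b c : ℝ, a + b + c - b - c = a := by intros; ring
  exact key _ _ _

include hcov in
lemma isPseudoHessian_of_globalChart (hsymm : ∀ y ∈ e.target, ∀ v w, G y v w = G y w v)
    (hnondeg : ∀ y ∈ e.target, ∀ v, (∀ w, G y v w = 0) → v = 0)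
    (hcodazzi : ∀ y ∈ e.target, ∀ u v w, fderiv ℝ G y u v w = fderiv ℝ G y v u w) :
    IsPseudoHessian cov g where
  affine := isAffine_of_globalChart he hcov
  metric := isPseudoRiemannian_of_globalChart he hg hsmooth hsymm hnondeg
  hessian := by
    intro x
    obtain ⟨B, hBo, hxB, hBt, φ, θ, hφs, hφ, hθ⟩ :=
      exists_hessian_potential e.open_target hsmooth hsymm hcodazzi (globalChart_mem_target he x)
    have hcont : Continuous e := by
      refine continuous_iff_continuousAt.2 fun z => e.continuousAt (globalChart_mem_source he z)
    have hrep : (φ ∘ e) ∘ e.symm =ᶠ[Filter.principal e.target] φ := by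
      intro z hz
      exact congrArg φ (e.right_inv hz)
    have hrep' (z : M) : (φ ∘ e) ∘ e.symm =ᶠ[𝓝 (e z)] φ :=
      hrep.filter_mono (Filter.le_principal_iff.2 (globalChart_target_mem_nhds he z))
    refine ⟨e ⁻¹' B, hBo.preimage hcont, hxB, φ ∘ e, ?_, ?_⟩
    · intro z hz
      refine ContMDiffAt.contMDiffWithinAt ?_
      rw [contMDiffAt_iff_globalChart he]
      exact (hφs.contDiffAt (hBo.mem_nhds hz)).congr_of_eventuallyEq (hrep' z)
    · intro X Y hX hY y hy
      have hd (z : M) (hz : e z ∈ B) (v : TangentSpace 𝓘(ℝ, E) z) :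
          mvfderiv 𝓘(ℝ, E) (φ ∘ e) z v = θ (e z) v := by
        rw [mvfderiv_globalChart_apply he (hrep' z) v, (hφ _ hz).fderiv]
      have hYd := (hY.contDiffAt_chartRep he y).differentiableAt (by simp)
      have h2 : (fun z => mvfderiv 𝓘(ℝ, E) (φ ∘ e) z (Y z)) ∘ e.symm =ᶠ[𝓝 (e y)]
          fun z => θ z (chartRep e Y z) := by
        filter_upwards [globalChart_target_mem_nhds he y, hBo.mem_nhds hy] with z hz hzB
        have := hd (e.symm z) (by rwa [e.right_inv hz]) (Y (e.symm z))
        rw [e.right_inv hz] at this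
        exact this
      have h3 := mvfderiv_globalChart_apply he h2 (X y)
      rw [fderiv_clm_apply (hθ _ hy).differentiableAt hYd, (hθ _ hy).fderiv] at h3
      have h4 := hd y hy (cov Y y (X y))
      rw [hcov] at h4
      rw [hcov, h4, h3, hg]
      -- In the chart X(dφ(Y)) = θ(DY·X) + G(X,Y), and dφ(∇_X Y) = θ(DY·X) is subtracted.
      have key (T D : ℝ) : T = D + T - D := by ring
      have h5 : G (e y) (X y) (Y y) = G (e y) (X y) (chartRep e Y (e y)) := by
        rw [chartRep_apply he]
      exact h5.trans (key _ _)

include hcov in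
-- S is DG in the chart, so by the same cancellation ∇S is the second derivative of G.
lemma isAffineSpecialReal_of_globalChart (h : IsPseudoHessian cov g)
    (hconst : ∀ y ∈ e.target, fderiv ℝ (fderiv ℝ G) y = 0) : IsAffineSpecialReal cov g where
  toIsPseudoHessian := h
  parallel := by
    intro W X Y Z hW hX hY hZ x
    have hWs := hW.contDiffAt_chartRep he x
    have hXd := (hX.contDiffAt_chartRep he x).differentiableAt (by simp)
    have hYs := hY.contDiffAt_chartRep he x
    have hZs := hZ.contDiffAt_chartRep he x
    have hYd := hYs.differentiableAt (by simp)
    have hZd := hZs.differentiableAt (by simp)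
    have hGs := hsmooth _ (globalChart_mem_target he x)
    have hcovd {Q : VField E M} (hQ : ContDiffAt ℝ ∞ (chartRep e Q) (e x)) :
        DifferentiableAt ℝ (chartRep e (fun y => cov Q y (W y))) (e x) := by
      refine DifferentiableAt.congr_of_eventuallyEq ?_ (chartRep_cov he hcov x)
      exact ((hQ.fderiv_right (m := ∞) (by simp)).differentiableAt (by simp)).clm_apply
        (hWs.differentiableAt (by simp))
    have h1 : nablaMetric cov g X Y Z ∘ e.symm =ᶠ[𝓝 (e x)]
        fun z => fderiv ℝ G z (chartRep e X z) (chartRep e Y z) (chartRep e Z z) := by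
      filter_upwards [globalChart_target_mem_nhds he x] with z hz
      have := nablaMetric_globalChart he hcov hg hsmooth (X := X)
        ((hY.contDiffAt_chartRep he (e.symm z)).differentiableAt (by simp))
        ((hZ.contDiffAt_chartRep he (e.symm z)).differentiableAt (by simp))
      rw [e.right_inv hz] at this
      exact this
    have h2 := (mvfderiv_globalChart_apply he h1 (W x)).trans
      (fderiv_trilin_apply ((hGs.fderiv_right (m := ∞) (by simp)).differentiableAt (by simp))
        hXd hYd hZd _)
    rw [hconst _ (globalChart_mem_target he x), chartRep_apply he, chartRep_apply he,
      chartRep_apply he] at h2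
    rw [h2, nablaMetric_globalChart he hcov hg hsmooth hYd hZd,
      nablaMetric_globalChart he hcov hg hsmooth (hcovd hYs) hZd,
      nablaMetric_globalChart he hcov hg hsmooth hYd (hcovd hZs), hcov, hcov, hcov]
    have key : ∀ a b c : ℝ, 0 + a + b + c - a - b - c = 0 := by intros; ring
    exact key _ _ _

end GlobalChartMetric

/-! ### The exponential action -/

section ExpAction

variable {A : Type*} [NormedAddCommGroup A] [NormedSpace ℝ A] [FiniteDimensional ℝ A]
  (mul : A →ₗ[ℝ] A →ₗ[ℝ] A)

instance : CompleteSpace (DualSpace A) := inferInstanceAs (CompleteSpace (A →L[ℝ] ℝ))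

lemma contDiff_exp {V : Type*} [NormedAddCommGroup V] [NormedSpace ℝ V] [CompleteSpace V] :
    ContDiff ℝ ∞ (NormedSpace.exp : (V →L[ℝ] V) → V →L[ℝ] V) :=
  contDiff_iff_contDiffAt.2 fun x => (NormedSpace.exp_analytic (𝕂 := ℝ) x).contDiffAt

lemma contDiff_expAction :
    ContDiff ℝ ∞ (fun p : A × DualSpace A => expAction mul p.1 p.2) :=
  (contDiff_exp.comp ((mulTransposeL mul).contDiff.comp contDiff_fst)).clm_apply contDiff_snd

lemma expAction_zero (μ : DualSpace A) : expAction mul 0 μ = μ := by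
  have h : mulTranspose mul 0 = 0 := (mulTransposeL mul).map_zero
  simp [expAction, h]

/-- The space `A · μ` of all `L_a* μ`. -/
def tangentSpan (μ : DualSpace A) : Submodule ℝ (DualSpace A) :=
  LinearMap.range ((mulTransposeL mul).flip μ).toLinearMap

lemma mem_imSharp_iff {μ ν : DualSpace A} :
    ν ∈ imSharp (dualBiv mul) μ ↔ ν ∈ tangentSpan mul μ := by
  constructor
  · rintro ⟨α, hα⟩
    obtain ⟨a, rfl⟩ := (toBidual A).surjective α
    exact ⟨a, (sharp_dualBiv mul μ a).symm.trans hα⟩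
  · rintro ⟨a, ha⟩
    exact ⟨toBidual A a, (sharp_dualBiv mul μ a).trans ha⟩

lemma hasStrictFDerivAt_expAction_zero (μ : DualSpace A) :
    HasStrictFDerivAt (fun u => expAction mul u μ) ((mulTransposeL mul).flip μ) 0 := by
  have h0 : mulTransposeL mul 0 = 0 := map_zero _
  have h1 : HasStrictFDerivAt (NormedSpace.exp : (DualSpace A →L[ℝ] DualSpace A) → _)
      (ContinuousLinearMap.id ℝ _) (mulTransposeL mul 0) := by
    rw [h0]; exact hasStrictFDerivAt_exp_zero
  have h2 := h1.comp 0 (mulTransposeL mul).hasStrictFDerivAt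
  exact ((ContinuousLinearMap.apply ℝ (DualSpace A) μ).hasStrictFDerivAt.comp 0 h2)

variable (mul_comm : ∀ a b, mul a b = mul b a)
    (mul_assoc : ∀ a b c, mul (mul a b) c = mul a (mul b c))

include mul_comm mul_assoc

/-- Transposition reverses the order of composition; commutativity of the algebra restores it. -/
lemma mulTranspose_mulTranspose (a b : A) (μ : DualSpace A) :
    mulTranspose mul a (mulTranspose mul b μ) = mulTranspose mul (mul a b) μ := by
  refine DualSpace.ext_apply fun c => ?_
  simp only [mulTranspose_apply]
  rw [mul_assoc, mul_left_comm_of mul mul_comm mul_assoc]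

lemma commute_mulTranspose (a b : A) :
    Commute (mulTranspose mul a) (mulTranspose mul b) := by
  ext1 μ
  change mulTranspose mul a (mulTranspose mul b μ) = mulTranspose mul b (mulTranspose mul a μ)
  rw [mulTranspose_mulTranspose mul mul_comm mul_assoc,
    mulTranspose_mulTranspose mul mul_comm mul_assoc, mul_comm]

lemma expAction_add (u v : A) (μ : DualSpace A) :
    expAction mul (u + v) μ = expAction mul u (expAction mul v μ) := by
  have h : mulTranspose mul (u + v) = mulTranspose mul u + mulTranspose mul v :=
    (mulTransposeL mul).map_add u v
  let _ : NormedAlgebra ℚ (DualSpace A →L[ℝ] DualSpace A) := NormedAlgebra.restrictScalars ℚ ℝ _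
  have h2 := NormedSpace.exp_add_of_commute (commute_mulTranspose mul mul_comm mul_assoc u v)
  rw [expAction, h, h2]
  rfl

lemma expAction_neg_expAction (u : A) (μ : DualSpace A) :
    expAction mul (-u) (expAction mul u μ) = μ := by
  rw [← expAction_add mul mul_comm mul_assoc, neg_add_cancel, expAction_zero]

lemma mulTranspose_expAction (a u : A) (μ : DualSpace A) :
    mulTranspose mul a (expAction mul u μ) = expAction mul u (mulTranspose mul a μ) := by
  have h := (commute_mulTranspose mul mul_comm mul_assoc a u).exp_right
  exact congrArg (fun L : DualSpace A →L[ℝ] DualSpace A => L μ) h.eq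

omit mul_comm mul_assoc in
lemma mem_expOrbit_self (μ : DualSpace A) : μ ∈ expOrbit mul μ := ⟨0, expAction_zero mul μ⟩

lemma expOrbit_subset {μ ν : DualSpace A} (h : ν ∈ expOrbit mul μ) :
    expOrbit mul ν ⊆ expOrbit mul μ := by
  obtain ⟨u, rfl⟩ := h
  rintro _ ⟨v, rfl⟩
  exact ⟨v + u, expAction_add mul mul_comm mul_assoc v u μ⟩

lemma expOrbit_symm {μ ν : DualSpace A} (h : ν ∈ expOrbit mul μ) : μ ∈ expOrbit mul ν := by
  obtain ⟨u, rfl⟩ := h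
  exact ⟨-u, expAction_neg_expAction mul mul_comm mul_assoc u μ⟩

/-- Without a unit, μ need not lie in A·μ; still A·μ is stable under every L_b*, because L_b*L_a*μ =
L_{ba}*μ. -/
lemma tangentSpan_le {μ ν : DualSpace A} (h : ν ∈ tangentSpan mul μ) :
    tangentSpan mul ν ≤ tangentSpan mul μ := by
  obtain ⟨a, rfl⟩ := h
  rintro _ ⟨b, rfl⟩
  exact ⟨mul b a, (mulTranspose_mulTranspose mul mul_comm mul_assoc b a μ).symm⟩

/-- Orbits lie in the affine subspaces `μ + A · μ`. -/
lemma expAction_sub_mem (u : A) (μ : DualSpace A) :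
    expAction mul u μ - μ ∈ tangentSpan mul μ := by
  have hs := NormedSpace.exp_series_hasSum_exp' (𝕂 := ℝ) (mulTranspose mul u)
  have hs2 := (ContinuousLinearMap.apply ℝ (DualSpace A) μ).hasSum hs
  -- Removing the zeroth term μ leaves positive powers of L_u* applied to μ. All of them lie in A·μ,
  -- which is closed.
  have hs3 := (hasSum_nat_add_iff' 1).2 hs2
  have hclosed : IsClosed (tangentSpan mul μ : Set (DualSpace A)) :=
    Submodule.closed_of_finiteDimensional _
  have hmem : ∀ n, (mulTranspose mul u ^ (n + 1)) μ ∈ tangentSpan mul μ := by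
    intro n
    induction n with
    | zero => exact ⟨u, by simp; rfl⟩
    | succ n ih =>
      rw [pow_succ']
      exact tangentSpan_le mul mul_comm mul_assoc ih ⟨u, rfl⟩
  have h := hclosed.mem_of_tendsto hs3 (Filter.Eventually.of_forall fun s =>
    Submodule.sum_mem _ fun n _ => Submodule.smul_mem _ _ (hmem n))
  simpa [expAction] using h

/-- L_a* commutes with Φ(u,·), so L_a*Φ(u,μ) = Φ(u, L_a*μ) differs from L_a*μ by an element of
A·L_a*μ and stays in A·μ. The action of -u gives the other inclusion. -/
lemma tangentSpan_expAction (u : A) (μ : DualSpace A) :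
    tangentSpan mul (expAction mul u μ) = tangentSpan mul μ := by
  have key (u : A) (μ : DualSpace A) :
      tangentSpan mul (expAction mul u μ) ≤ tangentSpan mul μ := by
    rintro _ ⟨a, rfl⟩
    have h1 := expAction_sub_mem mul mul_comm mul_assoc u (mulTranspose mul a μ)
    have h2 : mulTranspose mul a μ ∈ tangentSpan mul μ := ⟨a, rfl⟩
    have h3 := add_mem (tangentSpan_le mul mul_comm mul_assoc h2 h1) h2
    rw [sub_add_cancel, ← mulTranspose_expAction mul mul_comm mul_assoc] at h3
    exact h3
  refine (key u μ).antisymm ?_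
  have := key (-u) (expAction mul u μ)
  rwa [expAction_neg_expAction mul mul_comm mul_assoc] at this

lemma tangentSpan_of_mem_expOrbit {μ ν : DualSpace A} (h : ν ∈ expOrbit mul μ) :
    tangentSpan mul ν = tangentSpan mul μ := by
  obtain ⟨u, rfl⟩ := h
  exact tangentSpan_expAction mul mul_comm mul_assoc u μ

lemma mulTranspose_eq_zero_of_mem_expOrbit {μ ν : DualSpace A} (h : ν ∈ expOrbit mul μ) {a : A}
    (ha : mulTranspose mul a μ = 0) : mulTranspose mul a ν = 0 := by
  obtain ⟨u, rfl⟩ := h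
  rw [mulTranspose_expAction mul mul_comm mul_assoc, ha]
  exact map_zero _

end ExpAction

/-! ### Affine coordinates on orbits -/

section Frame

variable {A : Type*} [NormedAddCommGroup A] [NormedSpace ℝ A] [FiniteDimensional ℝ A]

/-- A linear parametrisation `ι` of `A · μ` by `E`, with a left inverse `P` defined on all of `A*`
and a lift `s` to `A`. -/
structure Frame (mul : A →ₗ[ℝ] A →ₗ[ℝ] A) (μ : DualSpace A)
    (E : Type*) [NormedAddCommGroup E] [NormedSpace ℝ E] where
  ι : E →L[ℝ] DualSpace A
  P : DualSpace A →L[ℝ] E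
  s : E →L[ℝ] A
  P_ι : ∀ v, P (ι v) = v
  mulTranspose_s : ∀ v, mulTranspose mul (s v) μ = ι v
  ι_P : ∀ w ∈ tangentSpan mul μ, ι (P w) = w

variable {E : Type*} [NormedAddCommGroup E] [NormedSpace ℝ E] [FiniteDimensional ℝ E]
  {mul : A →ₗ[ℝ] A →ₗ[ℝ] A} {μ : DualSpace A}

/-- P is a linear left inverse of ι, and s comes from a linear right inverse of a ↦ L_a*μ onto A·μ.
The space E is left free so that it can be the model space of any integral manifold through μ. -/
lemma Frame.nonempty (h : Module.finrank ℝ E = Module.finrank ℝ (tangentSpan mul μ)) :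
    Nonempty (Frame mul μ E) := by
  let Ψ : E ≃ₗ[ℝ] tangentSpan mul μ := LinearEquiv.ofFinrankEq _ _ h
  let ι : E →ₗ[ℝ] DualSpace A := (tangentSpan mul μ).subtype ∘ₗ Ψ.toLinearMap
  have hι : LinearMap.ker ι = ⊥ :=
    LinearMap.ker_eq_bot.2 ((tangentSpan mul μ).injective_subtype.comp Ψ.injective)
  obtain ⟨P, hP⟩ := LinearMap.exists_leftInverse_of_injective ι hι
  let T : A →ₗ[ℝ] tangentSpan mul μ := ((mulTransposeL mul).flip μ).toLinearMap.rangeRestrict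
  obtain ⟨S, hS⟩ := LinearMap.exists_rightInverse_of_surjective T
    (LinearMap.range_rangeRestrict _)
  refine ⟨⟨LinearMap.toContinuousLinearMap ι, LinearMap.toContinuousLinearMap P,
    LinearMap.toContinuousLinearMap (S ∘ₗ Ψ.toLinearMap), fun v => LinearMap.congr_fun hP v,
    fun v => ?_, fun w hw => ?_⟩⟩
  · exact congrArg Subtype.val (LinearMap.congr_fun hS (Ψ v))
  · have h1 : ι (Ψ.symm ⟨w, hw⟩) = w := congrArg Subtype.val (Ψ.apply_symm_apply ⟨w, hw⟩)
    change ι (P w) = w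
    conv_lhs => rw [← h1]
    have h2 : P (ι (Ψ.symm ⟨w, hw⟩)) = _ := LinearMap.congr_fun hP _
    rw [h2]
    exact h1

namespace Frame

variable (F : Frame mul μ E)

omit [FiniteDimensional ℝ E] in
lemma ι_mem (v : E) : F.ι v ∈ tangentSpan mul μ := ⟨F.s v, F.mulTranspose_s v⟩

omit [FiniteDimensional ℝ E] in
lemma ι_injective : Function.Injective F.ι := fun v w h => by
  rw [← F.P_ι v, h, F.P_ι]

include F in
omit [FiniteDimensional ℝ E] in
lemma finrank_eq : Module.finrank ℝ (tangentSpan mul μ) = Module.finrank ℝ E := by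
  have h : tangentSpan mul μ = LinearMap.range F.ι.toLinearMap := by
    ext w
    exact ⟨fun hw => ⟨F.P w, F.ι_P w hw⟩, by rintro ⟨v, rfl⟩; exact F.ι_mem v⟩
  rw [h]
  exact LinearMap.finrank_range_of_inj F.ι_injective

/-- The endomorphism `v ↦ P (L_{s v}* ν)` of the coordinate space. -/
def endo (ν : DualSpace A) : E →L[ℝ] E := (F.P.comp ((mulTransposeL mul).flip ν)).comp F.s

omit [FiniteDimensional ℝ E] in
lemma endo_apply (ν : DualSpace A) (v : E) : F.endo ν v = F.P (mulTranspose mul (F.s v) ν) := rfl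

omit [FiniteDimensional ℝ E] in
lemma endo_self : F.endo μ = 1 := by
  ext v : 1
  rw [endo_apply, F.mulTranspose_s, F.P_ι]
  rfl

omit [FiniteDimensional ℝ E] in
lemma contDiff_endo : ContDiff ℝ ∞ F.endo :=
  (contDiff_const.clm_comp (mulTransposeL mul).flip.contDiff).clm_comp contDiff_const

/-- At μ the endomorphism is the identity and units are open. This makes `lift` usable at nearby
points not yet known to lie on the orbit. -/
lemma eventually_isUnit_endo : ∀ᶠ ν in 𝓝 μ, IsUnit (F.endo ν) := by
  refine F.contDiff_endo.continuous.continuousAt.eventually_mem (Units.isOpen.mem_nhds ?_)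
  rw [endo_self]
  exact isUnit_one

/-- The lift `E → A` with `L_{lift ν v}* ν = ι v` for `ν` in the orbit of `μ`. -/
def lift (ν : DualSpace A) : E →L[ℝ] A := F.s.comp (Ring.inverse (F.endo ν))

lemma contDiffAt_lift {ν : DualSpace A} (hν : IsUnit (F.endo ν)) : ContDiffAt ℝ ∞ F.lift ν := by
  obtain ⟨u, hu⟩ := hν
  have h1 : ContDiffAt ℝ ∞ Ring.inverse (F.endo ν) := by
    rw [← hu]; exact contDiffAt_ringInverse ℝ u
  exact contDiffAt_const.clm_comp (h1.comp ν F.contDiff_endo.contDiffAt)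

/-- Invertibility of the endomorphism makes v ↦ L_{s v}*ν injective into A·ν, and equal dimensions
make it onto. No membership in the orbit is required, only that A·ν has the right dimension. -/
lemma mulTranspose_lift {ν : DualSpace A} (hν : IsUnit (F.endo ν))
    (hd : Module.finrank ℝ (tangentSpan mul ν) = Module.finrank ℝ E) {w : DualSpace A}
    (hw : w ∈ tangentSpan mul ν) : mulTranspose mul (F.lift ν (F.P w)) ν = w := by
  let T : E →ₗ[ℝ] tangentSpan mul ν :=
    ((mulTransposeL mul).flip ν).toLinearMap.rangeRestrict ∘ₗ F.s.toLinearMap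
  have hT (v : E) : (T v : DualSpace A) = mulTranspose mul (F.s v) ν := rfl
  have hinv (x : E) : Ring.inverse (F.endo ν) (F.endo ν x) = x :=
    congrArg (fun L : E →L[ℝ] E => L x) (Ring.inverse_mul_cancel _ hν)
  have hinj : Function.Injective T := by
    intro x y hxy
    rw [← hinv x, ← hinv y, endo_apply, endo_apply, ← hT, ← hT, hxy]
  obtain ⟨x, hx⟩ := (LinearMap.injective_iff_surjective_of_finrank_eq_finrank hd.symm).1 hinj
    ⟨w, hw⟩
  have hx' : mulTranspose mul (F.s x) ν = w := (hT x).symm.trans (congrArg Subtype.val hx)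
  have h1 : Ring.inverse (F.endo ν) (F.P w) = x := by rw [← hx', ← endo_apply, hinv]
  rw [lift, ContinuousLinearMap.comp_apply, h1, hx']

variable (mul_comm : ∀ a b, mul a b = mul b a)
    (mul_assoc : ∀ a b c, mul (mul a b) c = mul a (mul b c))

include mul_comm mul_assoc

/-- On the orbit A·ν = A·μ, where P is injective, and L_a*ν = 0 forces L_a*μ = 0. Hence the kernel
is zero, which suffices in finite dimension. -/
lemma isUnit_endo {ν : DualSpace A} (hν : ν ∈ expOrbit mul μ) : IsUnit (F.endo ν) := by
  have hinj : Function.Injective (F.endo ν) := by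
    refine (injective_iff_map_eq_zero _).2 fun v hv => ?_
    rw [endo_apply] at hv
    have h1 : mulTranspose mul (F.s v) ν ∈ tangentSpan mul μ := by
      rw [← tangentSpan_of_mem_expOrbit mul mul_comm mul_assoc hν]
      exact ⟨F.s v, rfl⟩
    have h2 : mulTranspose mul (F.s v) ν = 0 := by
      rw [← F.ι_P _ h1, hv, map_zero]
    have h3 := mulTranspose_eq_zero_of_mem_expOrbit mul mul_comm mul_assoc
      (expOrbit_symm mul mul_comm mul_assoc hν) h2
    rw [F.mulTranspose_s] at h3
    rw [← F.P_ι v, h3, map_zero]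
  rw [ContinuousLinearMap.isUnit_iff_bijective]
  exact ⟨hinj, LinearMap.injective_iff_surjective (f := (F.endo ν).toLinearMap).1 hinj⟩

lemma mulTranspose_lift_of_mem_expOrbit {ν : DualSpace A} (hν : ν ∈ expOrbit mul μ) (v : E) :
    mulTranspose mul (F.lift ν v) ν = F.ι v := by
  have h := tangentSpan_of_mem_expOrbit mul mul_comm mul_assoc hν
  have h1 := F.mulTranspose_lift (F.isUnit_endo mul_comm mul_assoc hν) (w := F.ι v)
    (by rw [h, F.finrank_eq]) (by rw [h]; exact F.ι_mem v)
  rwa [F.P_ι] at h1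

omit [FiniteDimensional ℝ E] in
lemma ι_P_sub {ν : DualSpace A} (hν : ν ∈ expOrbit mul μ) : μ + F.ι (F.P (ν - μ)) = ν := by
  obtain ⟨u, rfl⟩ := hν
  rw [F.ι_P _ (expAction_sub_mem mul mul_comm mul_assoc u μ), add_sub_cancel]

/-- The coordinate domain of the orbit. -/
def domain (_F : Frame mul μ E) : Set E := {x | μ + _F.ι x ∈ expOrbit mul μ}

/-- The orbit of `μ` is open in `μ + A · μ`. -/
lemma isOpen_domain : IsOpen F.domain := by
  rw [isOpen_iff_mem_nhds]
  intro x hx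
  set ν := μ + F.ι x with hν
  -- The orbit map at ν, read in coordinates, has surjective derivative at 0, so it sends
  -- neighbourhoods of 0 onto neighbourhoods of x; its values all lie in the domain.
  have hd : HasStrictFDerivAt (fun u => F.P (expAction mul u ν - μ))
      (F.P.comp ((mulTransposeL mul).flip ν)) 0 :=
    F.P.hasStrictFDerivAt.comp 0 ((hasStrictFDerivAt_expAction_zero mul ν).sub_const μ)
  have hsurj : LinearMap.range (F.P.comp ((mulTransposeL mul).flip ν)).toLinearMap = ⊤ := by
    rw [LinearMap.range_eq_top]
    intro v
    refine ⟨F.lift ν v, ?_⟩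
    exact (congrArg F.P (F.mulTranspose_lift_of_mem_expOrbit mul_comm mul_assoc hx v)).trans
      (F.P_ι v)
  have hmap := hd.map_nhds_eq_of_surj hsurj
  have h0 : F.P (expAction mul 0 ν - μ) = x := by
    rw [expAction_zero, hν, add_sub_cancel_left, F.P_ι]
  rw [h0] at hmap
  rw [← hmap, Filter.mem_map]
  refine Filter.univ_mem' fun u => ?_
  have hu : expAction mul u ν ∈ expOrbit mul μ :=
    expOrbit_subset mul mul_comm mul_assoc hx ⟨u, rfl⟩
  change μ + F.ι (F.P (expAction mul u ν - μ)) ∈ expOrbit mul μ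
  rwa [F.ι_P_sub mul_comm mul_assoc hu]

end Frame

end Frame

/-! ### The metric of an orbit in affine coordinates and its derivatives. -/

namespace Frame

variable {A : Type*} [NormedAddCommGroup A] [NormedSpace ℝ A] [FiniteDimensional ℝ A]
  {E : Type*} [NormedAddCommGroup E] [NormedSpace ℝ E] [FiniteDimensional ℝ E]
  {mul : A →ₗ[ℝ] A →ₗ[ℝ] A} {μ : DualSpace A} (F : Frame mul μ E)

/-- The affine parametrisation `x ↦ μ + ι x` of `μ + A · μ`. -/
def point (x : E) : DualSpace A := μ + F.ι x

omit [FiniteDimensional ℝ E] in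
lemma mem_domain {x : E} : x ∈ F.domain ↔ F.point x ∈ expOrbit mul μ := Iff.rfl

omit [FiniteDimensional ℝ E] in
lemma hasFDerivAt_point (x : E) : HasFDerivAt F.point F.ι x := F.ι.hasFDerivAt.const_add μ

omit [FiniteDimensional ℝ E] in
lemma contDiff_point : ContDiff ℝ ∞ F.point := contDiff_const.add F.ι.contDiff

/-- The pairing of `A` with `A · μ` in coordinates. -/
def pairing : A →L[ℝ] E →L[ℝ] ℝ := ContinuousLinearMap.flip (E := E) (F := A) (G := ℝ) F.ι

/-- The lift `E → A` at the point with coordinate `x`. -/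
def coordLift (x : E) : E →L[ℝ] A := F.lift (F.point x)

/-- The metric of the orbit in coordinates. -/
def metric (x : E) : E →L[ℝ] E →L[ℝ] ℝ := F.pairing.comp (F.coordLift x)

omit [FiniteDimensional ℝ E] in
lemma metric_apply (x v w : E) : F.metric x v w = F.ι w (F.coordLift x v) := rfl

variable (mul_comm : ∀ a b, mul a b = mul b a)
    (mul_assoc : ∀ a b c, mul (mul a b) c = mul a (mul b c))

include mul_comm mul_assoc

lemma ι_eq {x : E} (hx : x ∈ F.domain) (v : E) (a : A) :
    F.ι v a = F.point x (mul (F.coordLift x v) a) := by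
  rw [← F.mulTranspose_lift_of_mem_expOrbit mul_comm mul_assoc hx v]
  rfl

lemma contDiffAt_coordLift {x : E} (hx : x ∈ F.domain) : ContDiffAt ℝ ∞ F.coordLift x :=
  (F.contDiffAt_lift (F.isUnit_endo mul_comm mul_assoc hx)).comp x F.contDiff_point.contDiffAt

lemma differentiableAt_coordLift {x : E} (hx : x ∈ F.domain) :
    DifferentiableAt ℝ F.coordLift x :=
  (F.contDiffAt_coordLift mul_comm mul_assoc hx).differentiableAt (by simp)

lemma contDiffAt_metric {x : E} (hx : x ∈ F.domain) : ContDiffAt ℝ ∞ F.metric x :=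
  contDiffAt_const.clm_comp (F.contDiffAt_coordLift mul_comm mul_assoc hx)

lemma metric_eq {x : E} (hx : x ∈ F.domain) (v w : E) :
    F.metric x v w = F.point x (mul (F.coordLift x v) (F.coordLift x w)) := by
  rw [metric_apply, F.ι_eq mul_comm mul_assoc hx, mul_comm]

lemma metric_symm {x : E} (hx : x ∈ F.domain) (v w : E) : F.metric x v w = F.metric x w v := by
  rw [F.metric_eq mul_comm mul_assoc hx, F.metric_eq mul_comm mul_assoc hx, mul_comm]

/-- Testing against the coordinates of L_a*μ_x for each a in A, where μ_x is `F.point x`, gives (ι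
v)(a) = 0. -/
lemma metric_nondegenerate {x : E} (hx : x ∈ F.domain) {v : E} (h : ∀ w, F.metric x v w = 0) :
    v = 0 := by
  refine F.ι_injective ?_
  rw [map_zero]
  refine DualSpace.ext_apply fun a => ?_
  have h1 : mulTranspose mul a (F.point x) ∈ tangentSpan mul μ := by
    rw [← tangentSpan_of_mem_expOrbit mul mul_comm mul_assoc hx]
    exact ⟨a, rfl⟩
  have h2 := h (F.P (mulTranspose mul a (F.point x)))
  rw [metric_apply, F.ι_P _ h1, mulTranspose_apply] at h2
  rw [F.ι_eq mul_comm mul_assoc hx, mul_comm, h2]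
  rfl

/-- On the orbit the pairing μ_x(a_v(x) a) equals (ι v)(a), which does not depend on x.
Differentiating in the direction z, the base point moves by ι z = L_{a_z}*μ_x and produces the
product on the right. -/
lemma point_mul_fderiv_coordLift {x : E} (hx : x ∈ F.domain) (z v : E) (a : A) :
    F.point x (mul (fderiv ℝ F.coordLift x z v) a) =
      -F.point x (mul (F.coordLift x z) (mul (F.coordLift x v) a)) := by
  have hd := F.differentiableAt_coordLift mul_comm mul_assoc hx
  have hd1 : DifferentiableAt ℝ (fun y => F.coordLift y v) x :=
    hd.clm_apply (differentiableAt_const v)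
  have h1 : (fun y => F.point y (mul (F.coordLift y v) a)) =ᶠ[𝓝 x] fun _ => F.ι v a := by
    filter_upwards [(F.isOpen_domain mul_comm mul_assoc).mem_nhds hx] with y hy
    rw [F.ι_eq mul_comm mul_assoc hy]
  have h2 := fderiv_pairing (F.hasFDerivAt_point x).differentiableAt
    (differentiableAt_mul mul hd1 (differentiableAt_const a)) z
  rw [h1.fderiv_eq, (F.hasFDerivAt_point x).fderiv,
    fderiv_mul_apply mul hd1 (differentiableAt_const a),
    fderiv_clm_apply hd (differentiableAt_const v)] at h2
  simp only [fderiv_const_apply, ContinuousLinearMap.comp_zero, zero_add, zero_apply,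
    map_zero, ContinuousLinearMap.flip_apply, F.ι_eq mul_comm mul_assoc hx z] at h2
  exact eq_neg_of_add_eq_zero_right h2.symm

lemma fderiv_metric {x : E} (hx : x ∈ F.domain) (z v w : E) :
    fderiv ℝ F.metric x z v w =
      -F.point x (mul (F.coordLift x z) (mul (F.coordLift x v) (F.coordLift x w))) := by
  have hd := F.differentiableAt_coordLift mul_comm mul_assoc hx
  have h := ((ContinuousLinearMap.compL ℝ E A (E →L[ℝ] ℝ) F.pairing).hasFDerivAt.comp x
    hd.hasFDerivAt).fderiv
  have h1 : fderiv ℝ F.metric x z v w = F.ι w (fderiv ℝ F.coordLift x z v) :=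
    congrArg (fun L : E →L[ℝ] E →L[ℝ] E →L[ℝ] ℝ => L z v w) h
  rw [h1, F.ι_eq mul_comm mul_assoc hx, mul_comm,
    F.point_mul_fderiv_coordLift mul_comm mul_assoc hx]

lemma fderiv_metric_symm {x : E} (hx : x ∈ F.domain) (u v w : E) :
    fderiv ℝ F.metric x u v w = fderiv ℝ F.metric x v u w := by
  rw [F.fderiv_metric mul_comm mul_assoc hx, F.fderiv_metric mul_comm mul_assoc hx,
    mul_left_comm_of mul mul_comm mul_assoc]

/-- Dg is the cubic expression -μ_x(a_z a_v a_w). Differentiating it, whether at the base point or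
in one of the lifts, gives μ_x of a product of four elements. -/
lemma fderiv_fderiv_metric (h4 : ∀ a b c d, mul a (mul b (mul c d)) = 0) {x : E}
    (hx : x ∈ F.domain) : fderiv ℝ (fderiv ℝ F.metric) x = 0 := by
  ext u z v w
  have hd := F.differentiableAt_coordLift mul_comm mul_assoc hx
  have hd1 (v : E) : DifferentiableAt ℝ (fun y => F.coordLift y v) x :=
    hd.clm_apply (differentiableAt_const v)
  have hf (v : E) : fderiv ℝ (fun y => F.coordLift y v) x u = fderiv ℝ F.coordLift x u v := by
    rw [fderiv_clm_apply hd (differentiableAt_const v)]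
    simp
  have hG : DifferentiableAt ℝ (fderiv ℝ F.metric) x :=
    ((F.contDiffAt_metric mul_comm mul_assoc hx).fderiv_right (m := ∞) (by simp)).differentiableAt
      (by simp)
  have h1 := fderiv_trilin_apply hG (differentiableAt_const z) (differentiableAt_const v)
    (differentiableAt_const w) u
  have h2 : (fun y => fderiv ℝ F.metric y z v w) =ᶠ[𝓝 x]
      fun y => -F.point y (mul (F.coordLift y z) (mul (F.coordLift y v) (F.coordLift y w))) := by
    filter_upwards [(F.isOpen_domain mul_comm mul_assoc).mem_nhds hx] with y hy
    rw [F.fderiv_metric mul_comm mul_assoc hy]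
  have hvw := differentiableAt_mul mul (hd1 v) (hd1 w)
  have h3 := fderiv_pairing (F.hasFDerivAt_point x).differentiableAt
    (differentiableAt_mul mul (hd1 z) hvw) u
  -- Each differentiated lift is moved to the front of its product, where
  -- `point_mul_fderiv_coordLift` replaces it by two undifferentiated lifts.
  rw [fderiv_mul_apply mul (hd1 z) hvw, fderiv_mul_apply mul (hd1 v) (hd1 w), hf, hf, hf,
    (F.hasFDerivAt_point x).fderiv, map_add, map_add, map_add, F.ι_eq mul_comm mul_assoc hx,
    F.point_mul_fderiv_coordLift mul_comm mul_assoc hx,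
    mul_left_comm_of mul mul_comm mul_assoc _ (fderiv ℝ F.coordLift x u v),
    F.point_mul_fderiv_coordLift mul_comm mul_assoc hx, mul_comm _ (fderiv ℝ F.coordLift x u w),
    mul_left_comm_of mul mul_comm mul_assoc _ (fderiv ℝ F.coordLift x u w),
    F.point_mul_fderiv_coordLift mul_comm mul_assoc hx] at h3
  simp only [h4, map_zero, neg_zero, add_zero] at h3
  rw [h2.fderiv_eq, fderiv_fun_neg, neg_apply, h3] at h1
  simpa using h1.symm

end Frame

/-! ### Orbits as integral manifolds -/

section Orbit

universe u

variable {A : Type u} [NormedAddCommGroup A] [NormedSpace ℝ A] [FiniteDimensional ℝ A]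
  {mul : A →ₗ[ℝ] A →ₗ[ℝ] A} {μ : DualSpace A}
  (mul_comm : ∀ a b, mul a b = mul b a)
  (mul_assoc : ∀ a b c, mul (mul a b) c = mul a (mul b c))

namespace Frame

section

variable {E : Type*} [NormedAddCommGroup E] [NormedSpace ℝ E] [FiniteDimensional ℝ E]
  (F : Frame mul μ E)

include mul_comm mul_assoc

/-- The orbit is homeomorphic to its coordinate domain. -/
def homeomorph : expOrbit mul μ ≃ₜ F.domain where
  toFun ν := ⟨F.P (ν - μ), by
    rw [mem_domain, point, F.ι_P_sub mul_comm mul_assoc ν.2]; exact ν.2⟩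
  invFun x := ⟨F.point x, x.2⟩
  left_inv ν := Subtype.ext (F.ι_P_sub mul_comm mul_assoc ν.2)
  right_inv x := Subtype.ext (by simp [point, F.P_ι])
  continuous_toFun := by
    refine Continuous.subtype_mk ?_ _
    exact F.P.continuous.comp (continuous_subtype_val.sub continuous_const)
  continuous_invFun := by
    refine Continuous.subtype_mk ?_ _
    exact F.contDiff_point.continuous.comp continuous_subtype_val

/-- The global chart of the orbit. -/
def chart : OpenPartialHomeomorph (expOrbit mul μ) E where
  toFun ν := F.P (ν - μ)
  invFun x := by
    -- The value μ outside the domain is a mere default.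
    classical exact if hx : x ∈ F.domain then ⟨F.point x, hx⟩ else ⟨μ, mem_expOrbit_self mul μ⟩
  source := univ
  target := F.domain
  map_source' ν _ := ((F.homeomorph mul_comm mul_assoc) ν).2
  map_target' _ _ := mem_univ _
  left_inv' ν _ := by
    have h : F.P (ν - μ) ∈ F.domain := ((F.homeomorph mul_comm mul_assoc) ν).2
    rw [dif_pos h]
    exact (F.homeomorph mul_comm mul_assoc).left_inv ν
  right_inv' x hx := by
    rw [dif_pos hx]
    simp [point, F.P_ι]
  open_source := isOpen_univ
  open_target := F.isOpen_domain mul_comm mul_assoc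
  continuousOn_toFun := by
    exact (F.P.continuous.comp (continuous_subtype_val.sub continuous_const)).continuousOn
  continuousOn_invFun := by
    rw [continuousOn_iff_continuous_domRestrict]
    convert! (F.homeomorph mul_comm mul_assoc).continuous_invFun using 1
    ext1 x
    simp only [domRestrict_apply]
    rw [dif_pos x.2]
    rfl

lemma chart_source : (F.chart mul_comm mul_assoc).source = univ := rfl

lemma chart_symm_coe {x : E} (hx : x ∈ F.domain) :
    ((F.chart mul_comm mul_assoc).symm x : DualSpace A) = F.point x := by
  have h : (F.chart mul_comm mul_assoc).symm x = ⟨F.point x, hx⟩ := dif_pos hx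
  rw [h]

end

end Frame

lemma connectedSpace_expOrbit : ConnectedSpace (expOrbit mul μ) := by
  have h : IsConnected (expOrbit mul μ) := by
    refine isConnected_range ?_
    exact (contDiff_expAction mul).continuous.comp (continuous_id.prodMk continuous_const)
  exact isConnected_iff_connectedSpace.1 h

variable {d : ℕ} (F : Frame mul μ (EuclideanSpace ℝ (Fin d)))

/-- The orbit as a charted space. -/
@[reducible]
def orbitChartedSpace : ChartedSpace (EuclideanSpace ℝ (Fin d)) (expOrbit mul μ) :=
  (F.chart mul_comm mul_assoc).singletonChartedSpace
    (F.chart_source mul_comm mul_assoc)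

lemma orbit_incl_comp_chart_symm (ν : expOrbit mul μ) :
    (Subtype.val : expOrbit mul μ → DualSpace A) ∘ (F.chart mul_comm mul_assoc).symm
      =ᶠ[𝓝 (F.chart mul_comm mul_assoc ν)] F.point := by
  have hmem : F.chart mul_comm mul_assoc ν ∈ F.domain :=
    (F.chart mul_comm mul_assoc).map_source (mem_univ ν)
  filter_upwards [(F.isOpen_domain mul_comm mul_assoc).mem_nhds hmem] with x hx
  exact F.chart_symm_coe mul_comm mul_assoc hx

lemma mfderiv_orbit_incl (ν : expOrbit mul μ) :
    letI := orbitChartedSpace mul_comm mul_assoc F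
    mfderiv 𝓘(ℝ, EuclideanSpace ℝ (Fin d)) 𝓘(ℝ, DualSpace A)
      (Subtype.val : expOrbit mul μ → DualSpace A) ν = F.ι := by
  let _ := orbitChartedSpace mul_comm mul_assoc F
  rw [mfderiv_eq_globalChart (e := F.chart mul_comm mul_assoc) fun _ => rfl]
  exact (orbit_incl_comp_chart_symm mul_comm mul_assoc F ν).fderiv_eq.trans
    (F.hasFDerivAt_point _).fderiv

/-- The orbit of `μ` as an integral manifold of `Im h_#`. -/
def orbitManifold : IntegralManifold (imSharp (dualBiv mul)) :=
  letI := orbitChartedSpace mul_comm mul_assoc F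
  { dim := d
    carrier := expOrbit mul μ
    manifold := (F.chart mul_comm mul_assoc).isManifold_singleton
      (F.chart_source mul_comm mul_assoc)
    -- The carrier has the subspace topology of A*, from which this is inherited.
    secondCountable := by
      have := FiniteDimensional.proper_real (DualSpace A)
      infer_instance
    connected := connectedSpace_expOrbit
    incl := Subtype.val
    smooth := fun ν => by
      rw [contMDiffAt_iff_globalChart (e := F.chart mul_comm mul_assoc) fun _ => rfl]
      exact F.contDiff_point.contDiffAt.congr_of_eventuallyEq
        (orbit_incl_comp_chart_symm mul_comm mul_assoc F ν)
    injective := Subtype.val_injective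
    immersive := fun ν => by
      rw [mfderiv_orbit_incl]
      exact F.ι_injective
    tangent := fun ν => by
      rw [mfderiv_orbit_incl]
      ext w
      refine Iff.trans ?_ (mem_imSharp_iff mul).symm
      rw [tangentSpan_of_mem_expOrbit mul mul_comm mul_assoc ν.2]
      constructor
      · rintro ⟨v, rfl⟩
        exact F.ι_mem v
      · intro hw
        exact ⟨F.P w, F.ι_P w hw⟩ }

end Orbit

/-! ### Induced connection and induced metric of an orbit. -/

section OrbitGeometry

universe u

variable {A : Type u} [NormedAddCommGroup A] [NormedSpace ℝ A] [FiniteDimensional ℝ A]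
  {mul : A →ₗ[ℝ] A →ₗ[ℝ] A} {μ : DualSpace A}
  (mul_comm : ∀ a b, mul a b = mul b a)
  (mul_assoc : ∀ a b c, mul (mul a b) c = mul a (mul b c))
  {d : ℕ} (F : Frame mul μ (EuclideanSpace ℝ (Fin d)))

/-- The global chart of the orbit manifold. -/
def orbitChart : OpenPartialHomeomorph (orbitManifold mul_comm mul_assoc F).carrier
    (orbitManifold mul_comm mul_assoc F).Model :=
  F.chart mul_comm mul_assoc

lemma chartAt_orbitManifold (p : (orbitManifold mul_comm mul_assoc F).carrier) :
    chartAt (orbitManifold mul_comm mul_assoc F).Model p = orbitChart mul_comm mul_assoc F := rfl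

lemma point_orbitChart (p : (orbitManifold mul_comm mul_assoc F).carrier) :
    F.point (orbitChart mul_comm mul_assoc F p) = (orbitManifold mul_comm mul_assoc F).incl p :=
  F.ι_P_sub mul_comm mul_assoc p.2

lemma orbitChart_mem_domain (p : (orbitManifold mul_comm mul_assoc F).carrier) :
    orbitChart mul_comm mul_assoc F p ∈ F.domain :=
  (F.chart mul_comm mul_assoc).map_source (mem_univ p)

lemma mfderiv_orbitManifold_incl (p : (orbitManifold mul_comm mul_assoc F).carrier) :
    mfderiv 𝓘(ℝ, (orbitManifold mul_comm mul_assoc F).Model) 𝓘(ℝ, DualSpace A)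
      (orbitManifold mul_comm mul_assoc F).incl p = F.ι :=
  mfderiv_orbit_incl mul_comm mul_assoc F p

lemma range_orbitManifold_incl :
    range (orbitManifold mul_comm mul_assoc F).incl = expOrbit mul μ := Subtype.range_coe

/-- The connection of the orbit manifold. -/
def orbitConn : Conn (orbitManifold mul_comm mul_assoc F).Model
    (orbitManifold mul_comm mul_assoc F).carrier :=
  flatConn (chartAt_orbitManifold mul_comm mul_assoc F)

/-- The metric of the orbit manifold. -/
def orbitMetric : BiForm (orbitManifold mul_comm mul_assoc F).Model
    (orbitManifold mul_comm mul_assoc F).carrier :=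
  fun p => F.metric (orbitChart mul_comm mul_assoc F p)

/-- The inclusion is affine in the chart, with linear part ι. If Y' restricts to Y, then ι ∘ y = y'
∘ point near the given coordinate, and the chain rule gives the claim. -/
lemma isInducedConnection_orbitConn :
    (orbitManifold mul_comm mul_assoc F).IsInducedConnection (canonicalConn (DualSpace A))
      (orbitConn mul_comm mul_assoc F) := by
  intro X Y X' Y' hX hY hX' hY' p hpX hpY
  have he := chartAt_orbitManifold mul_comm mul_assoc F
  let e : OpenPartialHomeomorph (orbitManifold mul_comm mul_assoc F).carrier
    (orbitManifold mul_comm mul_assoc F).Model := orbitChart mul_comm mul_assoc F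
  let y : EuclideanSpace ℝ (Fin d) → EuclideanSpace ℝ (Fin d) :=
    chartRep (E := (orbitManifold mul_comm mul_assoc F).Model) e Y
  let x₀ : EuclideanSpace ℝ (Fin d) := e p
  have hx₀ : (orbitManifold mul_comm mul_assoc F).incl p = F.point x₀ :=
    (point_orbitChart mul_comm mul_assoc F p).symm
  have hYd : DifferentiableAt ℝ y x₀ :=
    (hY.contDiffAt_chartRep he p).differentiableAt (by simp)
  let y' : DualSpace A → DualSpace A := Y'
  have hYd' : DifferentiableAt ℝ y' (F.point x₀) :=
    ((vField_smooth_iff_globalChart (globalChart_vectorSpace (DualSpace A))).1 hY'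
      (F.point x₀)).differentiableAt (by simp)
  have hev : (fun z => F.ι (y z)) =ᶠ[𝓝 x₀] fun z => y' (F.point z) := by
    have h1 : Filter.Tendsto e.symm (𝓝 (e p)) (𝓝 p) := by
      have h2 := e.continuousAt_symm (globalChart_mem_target he p)
      rwa [ContinuousAt, globalChart_left_inv he] at h2
    filter_upwards [h1.eventually hpY, globalChart_target_mem_nhds he p] with z hz hzt
    have hp : (orbitManifold mul_comm mul_assoc F).incl (e.symm z) = F.point z :=
      (point_orbitChart mul_comm mul_assoc F (e.symm z)).symm.trans
        (congrArg F.point (e.right_inv hzt))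
    have hι := congrArg
      (fun L : EuclideanSpace ℝ (Fin d) →L[ℝ] DualSpace A => L (Y (e.symm z)))
      (mfderiv_orbitManifold_incl mul_comm mul_assoc F (e.symm z))
    exact (hι.symm.trans hz).trans (congrArg y' hp)
  have h1 : fderiv ℝ (fun z => F.ι (y z)) x₀ = F.ι.comp (fderiv ℝ y x₀) :=
    (F.ι.hasFDerivAt.comp x₀ hYd.hasFDerivAt).fderiv
  have h2 : fderiv ℝ (fun z => y' (F.point z)) x₀ =
      (fderiv ℝ y' (F.point x₀)).comp F.ι :=
    (hYd'.hasFDerivAt.comp x₀ (F.hasFDerivAt_point x₀)).fderiv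
  have h3 : F.ι.comp (fderiv ℝ y x₀) = (fderiv ℝ y' (F.point x₀)).comp F.ι := by
    rw [← h1, hev.fderiv_eq, h2]
  have h4 : F.ι (X p) = X' ((orbitManifold mul_comm mul_assoc F).incl p) := by
    have := hpX.self_of_nhds
    rw [mfderiv_orbitManifold_incl] at this
    exact this
  have h6 : F.ι (fderiv ℝ y x₀ (X p)) = fderiv ℝ y' (F.point x₀) (F.ι (X p)) :=
    congrArg (fun L : EuclideanSpace ℝ (Fin d) →L[ℝ] DualSpace A => L (X p)) h3
  rw [h4, ← hx₀] at h6
  rw [mfderiv_orbitManifold_incl]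
  exact h6

/-- With ν the base point, ι v = L_a*ν, ι w = L_b*ν and a_v the lift of v: g(v,w) = (ι w)(a_v) = ν(b
a_v) = (ι v)(b) = ν(ab). In particular the value does not depend on the choice of a and b. -/
lemma isInducedMetric_orbitMetric :
    (orbitManifold mul_comm mul_assoc F).IsInducedMetric (dualBiv mul)
      (orbitMetric mul_comm mul_assoc F) := by
  intro p v w α β hv hw
  obtain ⟨a, rfl⟩ := (toBidual A).surjective α
  obtain ⟨b, rfl⟩ := (toBidual A).surjective β
  rw [mfderiv_orbitManifold_incl] at hv hw
  have hv' : F.ι v = mulTranspose mul a ((orbitManifold mul_comm mul_assoc F).incl p) :=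
    hv.trans (sharp_dualBiv mul _ a)
  have hw' : F.ι w = mulTranspose mul b ((orbitManifold mul_comm mul_assoc F).incl p) :=
    hw.trans (sharp_dualBiv mul _ b)
  refine Eq.trans ?_ (dualBiv_apply mul _ a b).symm
  have h1 := F.ι_eq mul_comm mul_assoc (orbitChart_mem_domain mul_comm mul_assoc F p) v b
  rw [hv', mulTranspose_apply] at h1
  rw [h1]
  change F.metric (orbitChart mul_comm mul_assoc F p) v w = _
  refine (F.metric_apply _ v w).trans ?_
  rw [hw', mulTranspose_apply]
  exact congrArg₂ (fun (ν : DualSpace A) c => ν c) (point_orbitChart mul_comm mul_assoc F p).symm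
    (mul_comm _ _)

lemma isPseudoHessian_orbit :
    IsPseudoHessian (orbitConn mul_comm mul_assoc F) (orbitMetric mul_comm mul_assoc F) :=
  isPseudoHessian_of_globalChart (G := F.metric) (chartAt_orbitManifold mul_comm mul_assoc F)
    (fun _ _ => rfl) (fun _ => rfl) (fun _ hy => F.contDiffAt_metric mul_comm mul_assoc hy)
    (fun _ hy => F.metric_symm mul_comm mul_assoc hy)
    (fun _ hy _ => F.metric_nondegenerate mul_comm mul_assoc hy)
    (fun _ hy => F.fderiv_metric_symm mul_comm mul_assoc hy)

lemma isAffineSpecialReal_orbit (h4 : fourthPower mul = ⊥) :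
    IsAffineSpecialReal (orbitConn mul_comm mul_assoc F) (orbitMetric mul_comm mul_assoc F) :=
  isAffineSpecialReal_of_globalChart (G := F.metric)
    (chartAt_orbitManifold mul_comm mul_assoc F) (fun _ _ => rfl) (fun _ => rfl)
    (fun _ hy => F.contDiffAt_metric mul_comm mul_assoc hy)
    (isPseudoHessian_orbit mul_comm mul_assoc F)
    (fun _ hy => F.fderiv_fderiv_metric mul_comm mul_assoc
      ((fourthPower_eq_bot_iff mul mul_assoc).1 h4) hy)

end OrbitGeometry

/-! ### Integral manifolds stay in orbits -/

section Exp

variable {V : Type*} [NormedAddCommGroup V] [NormedSpace ℝ V] [CompleteSpace V]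

/-- Restricting to a time where the exponent vanishes avoids the derivative of exp at a general
operator: at 0 it is the identity. -/
lemma hasDerivAt_exp_apply {L : ℝ → V →L[ℝ] V} {L' : V →L[ℝ] V} {γ : ℝ → V} {γ' : V} {t : ℝ}
    (hL : HasDerivAt L L' t) (h0 : L t = 0) (hγ : HasDerivAt γ γ' t) :
    HasDerivAt (fun s => NormedSpace.exp (L s) (γ s)) (L' (γ t) + γ') t := by
  have hexp : HasFDerivAt (NormedSpace.exp : (V →L[ℝ] V) → V →L[ℝ] V)
      (1 : (V →L[ℝ] V) →L[ℝ] V →L[ℝ] V) (L t) := by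
    rw [h0]; exact hasFDerivAt_exp_zero
  have h := (hexp.comp_hasDerivAt t hL).clm_apply hγ
  simpa [h0] using h

end Exp

section IntegralCurve

variable {A : Type*} [NormedAddCommGroup A] [NormedSpace ℝ A] [FiniteDimensional ℝ A]
  (mul : A →ₗ[ℝ] A →ₗ[ℝ] A)
  (mul_comm : ∀ a b, mul a b = mul b a)
  (mul_assoc : ∀ a b c, mul (mul a b) c = mul a (mul b c))

include mul_comm mul_assoc

/-- By the action law, Φ(-U(s),·) factors as the fixed map Φ(-U(t),·) after Φ(-(U(s)-U(t)),·). The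
latter exponent vanishes at s = t, where the two derivative terms cancel. -/
lemma hasDerivAt_expAction_neg {U : ℝ → A} {γ : ℝ → DualSpace A} {t : ℝ} {u : A}
    (hU : HasDerivAt U u t) (hγ : HasDerivAt γ (mulTranspose mul u (γ t)) t) :
    HasDerivAt (fun s => expAction mul (-U s) (γ s)) 0 t := by
  have h1 : HasDerivAt (fun s => -(U s - U t)) (-u) t := (hU.sub_const (U t)).neg
  have h2 : HasDerivAt (fun s => mulTranspose mul (-(U s - U t))) (mulTranspose mul (-u)) t :=
    (mulTransposeL mul).hasFDerivAt.comp_hasDerivAt t h1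
  have h0 : mulTranspose mul (-(U t - U t)) = 0 := by
    rw [sub_self, neg_zero]; exact (mulTransposeL mul).map_zero
  have h3 : HasDerivAt (fun s => expAction mul (-(U s - U t)) (γ s)) 0 t := by
    have h4 := hasDerivAt_exp_apply h2 h0 hγ
    have h6 : mulTranspose mul (-u) (γ t) + mulTranspose mul u (γ t) = 0 := by
      have h7 : mulTranspose mul (-u) = -mulTranspose mul u := (mulTransposeL mul).map_neg u
      rw [h7]
      exact neg_add_cancel _
    rwa [h6] at h4
  have h4 : HasDerivAt (fun s => expAction mul (-U t) (expAction mul (-(U s - U t)) (γ s)))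
      (NormedSpace.exp (mulTranspose mul (-U t)) 0) t :=
    (NormedSpace.exp (mulTranspose mul (-U t))).hasFDerivAt.comp_hasDerivAt t h3
  have h5 (s : ℝ) : expAction mul (-U t) (expAction mul (-(U s - U t)) (γ s)) =
      expAction mul (-U s) (γ s) := by
    rw [← expAction_add mul mul_comm mul_assoc]
    congr 1
    abel
  simp only [h5, map_zero] at h4
  exact h4

/-- An integral curve of `Im h_#` stays in an orbit. -/
lemma mem_expOrbit_of_hasDerivAt {γ : ℝ → DualSpace A} {u : ℝ → A}
    (hu : ContinuousOn u (Icc 0 1))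
    (hγ : ∀ t ∈ Icc (0 : ℝ) 1, HasDerivAt γ (mulTranspose mul (u t) (γ t)) t) :
    γ 1 ∈ expOrbit mul (γ 0) := by
  -- Extended by its endpoint values, u becomes continuous on the whole line, so its integral has a
  -- two-sided derivative also at 0 and 1.
  let w : ℝ → A := IccExtend zero_le_one ((Icc (0 : ℝ) 1).domRestrict u)
  have hw : Continuous w := hu.domRestrict.Icc_extend'
  let U : ℝ → A := fun t => ∫ s in (0 : ℝ)..t, w s
  have hU (t : ℝ) : HasDerivAt U (w t) t := hw.integral_hasStrictDerivAt 0 t |>.hasDerivAt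
  have hwu {t : ℝ} (ht : t ∈ Icc (0 : ℝ) 1) : w t = u t := IccExtend_of_mem _ _ ht
  have hd (t : ℝ) (ht : t ∈ Icc (0 : ℝ) 1) :
      HasDerivAt (fun s => expAction mul (-U s) (γ s)) 0 t :=
    hasDerivAt_expAction_neg mul mul_comm mul_assoc (hU t) (by rw [hwu ht]; exact hγ t ht)
  have h := constant_of_has_deriv_right_zero
    (fun t ht => (hd t ht).continuousAt.continuousWithinAt)
    (fun t ht => (hd t (Ico_subset_Icc_self ht)).hasDerivWithinAt) 1 (by simp)
  have hU0 : U 0 = 0 := intervalIntegral.integral_same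
  rw [hU0, neg_zero, expAction_zero] at h
  refine ⟨U 1, ?_⟩
  change expAction mul (U 1) (γ 0) = γ 1
  rw [← h, ← expAction_add mul mul_comm mul_assoc, add_neg_cancel, expAction_zero]

/-- A map from an open set whose differential takes values in `Im h_#`, of constant rank along the
map, stays locally in an orbit. -/
lemma eventually_mem_expOrbit {E : Type*} [NormedAddCommGroup E] [NormedSpace ℝ E]
    [FiniteDimensional ℝ E] {γ : E → DualSpace A} {x₀ : E}
    (hγ : ContDiffAt ℝ ∞ γ x₀)
    (hrank : ∀ᶠ x in 𝓝 x₀, Module.finrank ℝ (tangentSpan mul (γ x)) = Module.finrank ℝ E)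
    (htan : ∀ᶠ x in 𝓝 x₀, ∀ v, fderiv ℝ γ x v ∈ tangentSpan mul (γ x)) :
    ∀ᶠ x in 𝓝 x₀, γ x ∈ expOrbit mul (γ x₀) := by
  obtain ⟨F⟩ := Frame.nonempty (mul := mul) hrank.self_of_nhds.symm
  have hγ' : ∀ᶠ x in 𝓝 x₀, ContDiffAt ℝ 1 γ x :=
    (hγ.of_le (by simp)).eventually (by simp)
  obtain ⟨r, hr, hball⟩ := Metric.eventually_nhds_iff_ball.1
    (((hrank.and htan).and hγ').and (hγ.continuousAt.eventually F.eventually_isUnit_endo))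
  refine Metric.eventually_nhds_iff_ball.2 ⟨r, hr, fun x hx => ?_⟩
  let c : ℝ → E := fun t => x₀ + t • (x - x₀)
  have hcd (t : ℝ) : HasDerivAt c (x - x₀) t := by
    have h := ((hasDerivAt_id t).smul_const (x - x₀)).const_add x₀
    rwa [one_smul] at h
  have hcball {t : ℝ} (ht : t ∈ Icc (0 : ℝ) 1) : c t ∈ Metric.ball x₀ r :=
    (convex_ball x₀ r).add_smul_sub_mem (Metric.mem_ball_self hr) hx ht
  -- Along the segment from x₀ to x, the lift of a frame at γ x₀ turns the velocity into a
  -- continuous curve in A. This is where constant rank is used.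
  have h := mem_expOrbit_of_hasDerivAt mul mul_comm mul_assoc (γ := γ ∘ c)
    (u := fun t => F.lift (γ (c t)) (F.P (fderiv ℝ γ (c t) (x - x₀)))) ?_ fun t ht => ?_
  · simpa [c] using h
  · intro t ht
    obtain ⟨⟨-, h1⟩, h2⟩ := hball _ (hcball ht)
    have hc : ContinuousAt c t := (hcd t).continuousAt
    have h3 : ContinuousAt (fun t => γ (c t)) t :=
      ContinuousAt.comp (g := γ) h1.continuousAt hc
    have h4 : ContinuousAt (fun t => F.lift (γ (c t))) t :=
      ContinuousAt.comp (g := F.lift) (F.contDiffAt_lift h2).continuousAt h3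
    have h5 : ContinuousAt (fun t => fderiv ℝ γ (c t)) t :=
      ContinuousAt.comp (g := fderiv ℝ γ) (h1.continuousAt_fderiv (by simp)) hc
    exact (h4.clm_apply (F.P.continuous.continuousAt.comp
      (h5.clm_apply continuousAt_const))).continuousWithinAt
  · obtain ⟨⟨⟨h0, h1⟩, h2⟩, h3⟩ := hball _ (hcball ht)
    have h4 := (h2.differentiableAt (by simp)).hasFDerivAt.comp_hasDerivAt t (hcd t)
    convert! h4 using 1
    exact F.mulTranspose_lift h3 h0 (h1 _)

end IntegralCurve

/-! ### Orbits are the leaves. -/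

section OrbitLeaf

universe u

variable {A : Type u} [NormedAddCommGroup A] [NormedSpace ℝ A] [FiniteDimensional ℝ A]
  {mul : A →ₗ[ℝ] A →ₗ[ℝ] A}

namespace IntegralManifold

variable (L : IntegralManifold (imSharp (dualBiv mul)))

/-- The inclusion of an integral manifold, read in the chart at `p`. -/
def localIncl (p : L.carrier) (x : L.Model) : DualSpace A := L.incl ((chartAt L.Model p).symm x)

/-- Immersivity forces the rank of Im h_# to be the dimension of L at each of its points, which is
the constant rank that `eventually_mem_expOrbit` needs. -/
lemma finrank_tangentSpan (p : L.carrier) :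
    Module.finrank ℝ (tangentSpan mul (L.incl p)) = Module.finrank ℝ L.Model := by
  let f : L.Model →ₗ[ℝ] DualSpace A :=
    (mfderiv 𝓘(ℝ, L.Model) 𝓘(ℝ, DualSpace A) L.incl p).toLinearMap
  have h : tangentSpan mul (L.incl p) = LinearMap.range f := by
    ext w
    rw [← mem_imSharp_iff, ← L.tangent p]
    rfl
  rw [h]
  exact LinearMap.finrank_range_of_inj (f := f) (L.immersive p)

lemma contDiffAt_localIncl (p : L.carrier) {x : L.Model} (hx : x ∈ (chartAt L.Model p).target) :
    ContDiffAt ℝ ∞ (L.localIncl p) x := by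
  have h : ContMDiffAt 𝓘(ℝ, L.Model) 𝓘(ℝ, L.Model) ∞ (chartAt L.Model p).symm x :=
    (contMDiffOn_chart_symm (I := 𝓘(ℝ, L.Model)) (x := p)).contMDiffAt
      ((chartAt L.Model p).open_target.mem_nhds hx)
  exact (L.smooth.contMDiffAt.comp x h).contDiffAt

lemma fderiv_localIncl_mem (p : L.carrier) {x : L.Model} (hx : x ∈ (chartAt L.Model p).target)
    (v : L.Model) : fderiv ℝ (L.localIncl p) x v ∈ tangentSpan mul (L.localIncl p x) := by
  have h : MDifferentiableAt 𝓘(ℝ, L.Model) 𝓘(ℝ, L.Model) (chartAt L.Model p).symm x :=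
    ((contMDiffOn_chart_symm (I := 𝓘(ℝ, L.Model)) (n := ∞) (x := p)).contMDiffAt
      ((chartAt L.Model p).open_target.mem_nhds hx)).mdifferentiableAt (by simp)
  have h1 := mfderiv_comp x (L.smooth.contMDiffAt.mdifferentiableAt (by simp)) h
  rw [← mfderiv_eq_fderiv]
  refine (mem_imSharp_iff mul).1 ?_
  have h2 := L.tangent ((chartAt L.Model p).symm x)
  change _ ∈ imSharp (dualBiv mul) (L.incl ((chartAt L.Model p).symm x))
  rw [← h2]
  exact ⟨_, (congrArg (fun f : L.Model →L[ℝ] DualSpace A => f v) h1).symm⟩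

lemma fderiv_localIncl (p : L.carrier) :
    fderiv ℝ (L.localIncl p) (chartAt L.Model p p) =
      mfderiv 𝓘(ℝ, L.Model) 𝓘(ℝ, DualSpace A) L.incl p := by
  refine Eq.trans ?_ (L.smooth.contMDiffAt.mdifferentiableAt (x := p) (by simp)).mfderiv.symm
  simp only [mfld_simps, fderivWithin_univ]
  rfl

variable (mul_comm : ∀ a b, mul a b = mul b a)
  (mul_assoc : ∀ a b c, mul (mul a b) c = mul a (mul b c))

include mul_comm mul_assoc

lemma eventually_incl_mem_expOrbit (p : L.carrier) :
    ∀ᶠ q in 𝓝 p, L.incl q ∈ expOrbit mul (L.incl p) := by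
  set e := chartAt L.Model p with he
  have hx : e p ∈ e.target := mem_chart_target L.Model p
  have h := eventually_mem_expOrbit mul mul_comm mul_assoc (γ := L.localIncl p) (x₀ := e p)
    (L.contDiffAt_localIncl p hx) (.of_forall fun x => L.finrank_tangentSpan _) (by
      filter_upwards [e.open_target.mem_nhds hx] with x hx
      exact L.fderiv_localIncl_mem p hx)
  have h1 := (e.continuousAt (mem_chart_source L.Model p)).eventually h
  filter_upwards [h1, e.open_source.mem_nhds (mem_chart_source L.Model p)] with q hq hqs
  rwa [localIncl, localIncl, ← he, e.left_inv hqs, e.left_inv (mem_chart_source L.Model p)] at hq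

/-- Orbits partition A*, and the inclusion stays locally in one orbit, so the preimage of an orbit
is both open and closed. The connected carrier leaves no other possibility. -/
lemma range_incl_subset {μ : DualSpace A} (h : (range L.incl ∩ expOrbit mul μ).Nonempty) :
    range L.incl ⊆ expOrbit mul μ := by
  obtain ⟨_, ⟨p, rfl⟩, hp⟩ := h
  have hiff (p : L.carrier) :
      ∀ᶠ q in 𝓝 p, (L.incl q ∈ expOrbit mul μ ↔ L.incl p ∈ expOrbit mul μ) := by
    filter_upwards [L.eventually_incl_mem_expOrbit mul_comm mul_assoc p] with q hq
    exact ⟨fun h => expOrbit_subset mul mul_comm mul_assoc h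
        (expOrbit_symm mul mul_comm mul_assoc hq),
      fun h => expOrbit_subset mul mul_comm mul_assoc h hq⟩
  have hclopen : IsClopen (L.incl ⁻¹' expOrbit mul μ) := by
    refine ⟨isOpen_compl_iff.1 (isOpen_iff_mem_nhds.2 fun q hq => ?_),
      isOpen_iff_mem_nhds.2 fun q hq => ?_⟩
    · filter_upwards [hiff q] with r hr using fun h => hq (hr.1 h)
    · filter_upwards [hiff q] with r hr using hr.2 hq
  have huniv := hclopen.eq_univ ⟨p, hp⟩
  rintro _ ⟨q, rfl⟩
  exact huniv.ge (mem_univ q)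

end IntegralManifold

variable {μ : DualSpace A}
  (mul_comm : ∀ a b, mul a b = mul b a)
  (mul_assoc : ∀ a b c, mul (mul a b) c = mul a (mul b c))
  {d : ℕ} (F : Frame mul μ (EuclideanSpace ℝ (Fin d)))

/-- An integral manifold meeting the orbit lies in it, so j is its inclusion with restricted
codomain. Continuity and smoothness of j follow because the orbit is embedded, with chart the
restriction of the affine map P(ν - μ). Openness holds because the derivative of j in charts is
onto. -/
lemma isLeaf_orbitManifold : (orbitManifold mul_comm mul_assoc F).IsLeaf := by
  intro L hL
  rw [range_orbitManifold_incl] at hL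
  have hsub := L.range_incl_subset mul_comm mul_assoc hL
  have hmem (p : L.carrier) : L.incl p ∈ expOrbit mul μ := hsub ⟨p, rfl⟩
  let e := F.chart mul_comm mul_assoc
  let j : L.carrier → expOrbit mul μ := fun p => ⟨L.incl p, hmem p⟩
  have hj : Continuous j := L.smooth.continuous.subtype_mk _
  have hopen : IsOpenMap j := by
    refine isOpenMap_iff_nhds_le.2 fun p => ?_
    let c := chartAt L.Model p
    have hp : p ∈ c.source := mem_chart_source L.Model p
    let g : L.Model → EuclideanSpace ℝ (Fin d) := fun x => F.P (L.localIncl p x - μ)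
    have hstrict : HasStrictFDerivAt g (F.P.comp (fderiv ℝ (L.localIncl p) (c p))) (c p) :=
      F.P.hasStrictFDerivAt.comp _ (((L.contDiffAt_localIncl p
        (mem_chart_target L.Model p)).hasStrictFDerivAt (by simp)).sub_const μ)
    have hspan : tangentSpan mul (L.incl p) = tangentSpan mul μ :=
      tangentSpan_of_mem_expOrbit mul mul_comm mul_assoc (hmem p)
    have hsurj : LinearMap.range (F.P.comp (fderiv ℝ (L.localIncl p) (c p))).toLinearMap = ⊤ := by
      rw [LinearMap.range_eq_top]
      intro v
      have hv : F.ι v ∈ imSharp (dualBiv mul) (L.incl p) := by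
        rw [mem_imSharp_iff, hspan]
        exact F.ι_mem v
      rw [← L.tangent p] at hv
      obtain ⟨w, hw⟩ := hv
      refine ⟨w, ?_⟩
      have h1 : fderiv ℝ (L.localIncl p) (c p) w = F.ι v :=
        (congrArg (fun f : L.Model →L[ℝ] DualSpace A => f w) (L.fderiv_localIncl p)).trans hw
      exact (congrArg F.P h1).trans (F.P_ι v)
    -- The coordinate expression of j is open at p; the two charts then carry this back to j itself.
    have hmap := hstrict.map_nhds_eq_of_surj hsurj
    have hg (q : L.carrier) (hq : q ∈ c.source) : g (c q) = e (j q) :=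
      congrArg (fun q => F.P (L.incl q - μ)) (c.left_inv hq)
    have h1 : Filter.map (fun q => e (j q)) (𝓝 p) = 𝓝 (e (j p)) := by
      rw [← hg p hp, ← hmap, ← c.map_nhds_eq hp, Filter.map_map]
      refine Filter.map_congr ?_
      filter_upwards [c.open_source.mem_nhds hp] with q hq using (hg q hq).symm
    rw [← e.symm_map_nhds_eq (mem_univ (j p)), ← h1, Filter.map_map]
    refine (Filter.map_congr (.of_forall fun q => ?_)).le
    exact e.left_inv (mem_univ (j q))
  refine ⟨j, rfl, .of_continuous_injective_isOpenMap hj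
    (fun p q hpq => L.injective (congrArg Subtype.val hpq)) hopen, fun p => ?_⟩
  refine contMDiffAt_iff_target.2 ⟨hj.continuousAt, ?_⟩
  have h : ContMDiffAt 𝓘(ℝ, L.Model) 𝓘(ℝ, EuclideanSpace ℝ (Fin d)) ∞
      (fun q => F.P (L.incl q - μ)) p :=
    ContMDiffAt.comp (g := fun ν => F.P (ν - μ)) (I' := 𝓘(ℝ, DualSpace A)) p
      (F.P.contDiff.comp (contDiff_id.sub contDiff_const)).contMDiff.contMDiffAt
      L.smooth.contMDiffAt
  exact h

lemma Frame.exists_euclidean (mul : A →ₗ[ℝ] A →ₗ[ℝ] A) (μ : DualSpace A) :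
    ∃ d : ℕ, Nonempty (Frame mul μ (EuclideanSpace ℝ (Fin d))) :=
  ⟨Module.finrank ℝ (tangentSpan mul μ), Frame.nonempty (by simp)⟩

include mul_comm mul_assoc in
-- The orbit through a point of L is itself an integral manifold meeting L, so the maximality of L
-- gives the inclusion that `range_incl_subset` does not.
lemma IntegralManifold.IsLeaf.range_incl_eq {L : IntegralManifold (imSharp (dualBiv mul))}
    (hL : L.IsLeaf) (p : L.carrier) : range L.incl = expOrbit mul (L.incl p) := by
  have hp := mem_expOrbit_self mul (L.incl p)
  refine (L.range_incl_subset mul_comm mul_assoc ⟨_, ⟨p, rfl⟩, hp⟩).antisymm ?_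
  obtain ⟨d, ⟨F⟩⟩ := Frame.exists_euclidean mul (L.incl p)
  have hr := range_orbitManifold_incl mul_comm mul_assoc F
  obtain ⟨j, hj, -⟩ := hL (orbitManifold mul_comm mul_assoc F)
    ⟨L.incl p, by rw [hr]; exact hp, ⟨p, rfl⟩⟩
  rw [← hr, ← hj]
  exact range_comp_subset_range _ _

end OrbitLeaf

end PseudoHessian

end

open PseudoHessian in
theorem theorem7p2 {A : Type*} [NormedAddCommGroup A] [NormedSpace ℝ A] [FiniteDimensional ℝ A]
    (mul : A →ₗ[ℝ] A →ₗ[ℝ] A)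
    (mul_comm : ∀ a b, mul a b = mul b a)
    (mul_assoc : ∀ a b c, mul (mul a b) c = mul a (mul b c)) :
    IsGenPseudoHessian (canonicalConn (DualSpace A)) (dualBiv mul) ∧
    ((∀ μ, expAction mul 0 μ = μ) ∧
      (∀ u v μ, expAction mul (u + v) μ = expAction mul u (expAction mul v μ)) ∧
      ContDiff ℝ ∞ (fun p : A × DualSpace A => expAction mul p.1 p.2)) ∧
    (∀ L : IntegralManifold (imSharp (dualBiv mul)), L.IsLeaf →
      ∃ μ, Set.range L.incl = expOrbit mul μ) ∧
    (∀ μ, ∃ L : IntegralManifold (imSharp (dualBiv mul)), L.IsLeaf ∧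
      Set.range L.incl = expOrbit mul μ ∧
      ∃ (covL : Conn L.Model L.carrier) (g : BiForm L.Model L.carrier),
        L.IsInducedConnection (canonicalConn (DualSpace A)) covL ∧
        L.IsInducedMetric (dualBiv mul) g ∧
        IsPseudoHessian covL g ∧
        (fourthPower mul = ⊥ → IsAffineSpecialReal covL g)) ∧
    (IsGenAffineSpecialReal (canonicalConn (DualSpace A)) (dualBiv mul) ↔ fourthPower mul = ⊥) := by
  refine ⟨isGenPseudoHessian_dualBiv mul mul_comm mul_assoc,
    ⟨expAction_zero mul, expAction_add mul mul_comm mul_assoc, contDiff_expAction mul⟩,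
    fun L hL => ?_, fun μ => ?_, isGenAffineSpecialReal_dualBiv_iff mul mul_comm mul_assoc⟩
  · obtain ⟨p⟩ : Nonempty L.carrier := inferInstance
    exact ⟨L.incl p, hL.range_incl_eq mul_comm mul_assoc p⟩
  · obtain ⟨d, ⟨F⟩⟩ := Frame.exists_euclidean mul μ
    exact ⟨orbitManifold mul_comm mul_assoc F, isLeaf_orbitManifold mul_comm mul_assoc F,
      range_orbitManifold_incl mul_comm mul_assoc F, orbitConn mul_comm mul_assoc F,
      orbitMetric mul_comm mul_assoc F, isInducedConnection_orbitConn mul_comm mul_assoc F,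
      isInducedMetric_orbitMetric mul_comm mul_assoc F, isPseudoHessian_orbit mul_comm mul_assoc F,
      isAffineSpecialReal_orbit mul_comm mul_assoc F⟩
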